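/- **Setting.** For a complex matrix $M\in\mathbb C^{2^r\times 2^r}$ (indexed by $\{0,1\}^r$) and a sequence $T\in[n]^r$ of $r$ distinct qubits, let $M_T=M|_T\otimes\mathrm{Id}_{[n]\setminus T}$ act on $\mathbb C^{\{0,1\}^n}$. An $r$-local Hamiltonian $\mathcal H=\{(T_i,M_i):i\in[m]\}$ on $n$ qubits has energy $\mathcal E_{\mathcal H}(\psi)=\sum_{i=1}^m\langle\psi,(M_i)_{T_i}\psi\rangle$. Weights $w:[m]\to\mathbb R_{\ge0}$ are an $\varepsilon$-sparsifier of $\mathcal H$ if $$(1-\varepsilon)\,\mathcal E_{\mathcal H}(\psi)\;\le\;\sum_{i=1}^m w(i)\,\langle\psi,(M_i)_{T_i}\psi\rangle\;\le\;(1+\varepsilon)\,\mathcal E_{\mathcal H}(\psi)\qquad\text{for all }\psi\in\mathbb C^{\{0,1\}^n};$$ the size of $w$ is $|\{i:w(i)>0\}|$. An *admissible law of rank $R$* is a probability distribution $D$ on $\mathbb C^{2^r\times 2^r}$ that is the law of a random matrix $M$ for which there are random vectors $v_1,\dots,v_R\in\mathbb C^{2^r}$, defined jointly with $M$ and with absolutely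 continuous joint distribution, and a constant $B$, such that almost surely $M$ is Hermitian positive semidefinite, $\operatorname{rank}M=R$, the column span of $M$ is $\operatorname{span}(v_1,\dots,v_R)$, and $\|M\|_{\mathrm{op}}\le B$. Algorithms are while-programs, with rational constants, for a real RAM: an integer memory (addition, truncated subtraction, comparison) and a real memory (exact field operations, comparison), with indirect addressing, conversion of integers to reals, independent fair coin flips, and unit cost per instruction and per test. The input consists of $n$, $m$, the $T_i$, the entries of the $M_i$ (real and imaginary parts), and $\varepsilon$; the output is $w(1),\dots,w(m)$. **Theorem.** There are absolute constants $c>0$ and $k,K\in\mathbb N$ such that the following holds. Let $r\ge1$, $R\ge2^{r-1}+1$, and let $D$ be an admissible law of rank $R$ on $\mathbb C^{2^r\times2^r}$. Then there are a constant $C$ and a randomized algorithm $A$, both depending only on $r,R,D$, such that: 1. For all $n,m$, all $T_1,\dots,T_m\in[n]^r$ (each with distinct entries), all $M_1,\dots,M_m\in\mathbb C^{2^r\times2^r}$, all $\varepsilon>0$ and all outcomes of the coin flips, $A$ halts after at most $K(n+m+1)^K$ steps. 2. For all $n,m$, all $T_1,\dots,T_m\in[n]^r$ (each with distinct entries) and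 all $\varepsilon>0$: if $M_1,\dots,M_m$ are drawn independently from $D$, then, with probability at least $1-2^{-cn}$ jointly over $M_1,\dots,M_m$ and the independent coin flips of $A$, the output $w$ of $A$ on input $(\mathcal H,\varepsilon)$, $\mathcal H=\{(T_i,M_i):i\in[m]\}$, is an $\varepsilon$-sparsifier of $\mathcal H$ of size at most $$C\,\varepsilon^{-2}\,n\,\log(n+2)^k .$$ -/

import Mathlib

open MeasureTheory
open scoped ComplexOrder

noncomputable section

/-! ## Local Hamiltonians and their sparsifiers -/

/-- Complex `2^r × 2^r` matrices, with rows and columns indexed by bit strings of length `r`. -/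
abbrev QMat (r : ℕ) : Type := Matrix (Fin r → Fin 2) (Fin r → Fin 2) ℂ

/-- The Borel (product) structure on matrices, entry by entry. -/
instance QMat.measurableSpace (r : ℕ) : MeasurableSpace (QMat r) :=
  inferInstanceAs (MeasurableSpace ((Fin r → Fin 2) → (Fin r → Fin 2) → ℂ))

/-- `m` terms on `n` qubits: the `i`-th term applies the matrix `pred i` to the sequence
`qubits i` of `r` distinct qubits. -/
structure LocalHamiltonian (n m r : ℕ) where
  qubits : Fin m → (Fin r ↪ Fin n)
  pred : Fin m → QMat r

/-- The operator `M|_T ⊗ Id` on `n` qubits: its `(x, y)` entry is `M (x|_T) (y|_T)` if `x` and `y`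
agree outside `T`, and `0` otherwise. -/
def liftTerm {n r : ℕ} (T : Fin r ↪ Fin n) (M : QMat r) : QMat n :=
  open Classical in
  fun x y => if ∀ q, q ∉ Set.range T → x q = y q then M (x ∘ T) (y ∘ T) else 0

/-- The energy `⟨ψ, M_T ψ⟩` (a real number when `M` is Hermitian; states are not normalized). -/
def termEnergy {n r : ℕ} (T : Fin r ↪ Fin n) (M : QMat r) (ψ : (Fin n → Fin 2) → ℂ) : ℝ :=
  (star ψ ⬝ᵥ (liftTerm T M).mulVec ψ).re

namespace LocalHamiltonian

variable {n m r : ℕ}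

/-- The energy of a state. -/
def energy (H : LocalHamiltonian n m r) (ψ : (Fin n → Fin 2) → ℂ) : ℝ :=
  ∑ i, termEnergy (H.qubits i) (H.pred i) ψ

/-- The energy of a state after reweighting the terms by `w`. -/
def weightedEnergy (H : LocalHamiltonian n m r) (w : Fin m → ℝ) (ψ : (Fin n → Fin 2) → ℂ) : ℝ :=
  ∑ i, w i * termEnergy (H.qubits i) (H.pred i) ψ

/-- `w` is an `ε`-sparsifier: nonnegative weights that preserve the energy of every state up to a
factor in `[1 - ε, 1 + ε]`. -/
def IsSparsifier (H : LocalHamiltonian n m r) (ε : ℝ) (w : Fin m → ℝ) : Prop :=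
  (∀ i, 0 ≤ w i) ∧
    ∀ ψ : (Fin n → Fin 2) → ℂ,
      (1 - ε) * H.energy ψ ≤ H.weightedEnergy w ψ ∧
        H.weightedEnergy w ψ ≤ (1 + ε) * H.energy ψ

end LocalHamiltonian

/-- The size of a weight function: the number of terms of positive weight. -/
def weightSize {m : ℕ} (w : Fin m → ℝ) : ℕ := {i | 0 < w i}.ncard

/-! ## Random predicate matrices -/

/-- `D` is the law of a random positive semidefinite matrix `M` of rank `R` whose column span is
`span (v₁, …, v_R)`, where the random vectors `v₁, …, v_R` (defined jointly with `M`; `ν` is the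
joint law) have an absolutely continuous joint distribution, and `M` is uniformly bounded in
operator norm. -/
def IsPredicateLaw (r R : ℕ) (D : Measure (QMat r)) : Prop :=
  ∃ (B : ℝ) (ν : Measure (QMat r × (Fin R → (Fin r → Fin 2) → ℂ))),
    ν.map Prod.fst = D ∧
    ν.map Prod.snd ≪ volume ∧
    ∀ᵐ p ∂ν, p.1.PosSemidef ∧ p.1.rank = R ∧
      LinearMap.range p.1.mulVecLin = Submodule.span ℂ (Set.range p.2) ∧
      ‖Matrix.toEuclideanCLM (n := Fin r → Fin 2) (𝕜 := ℂ) p.1‖ ≤ B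

/-! ## Randomized algorithms: a real RAM with coin flips and a step count

The machine has an integer memory and a real memory, each an infinite array of cells holding `0` at
the start, a read-only input (integers and reals), a write-only output array of reals, and an
infinite tape of random bits, read once from left to right. Integers can only be added, subtracted
and compared; reals support exact field operations and comparison. There is no rounding, and
the constants of a program are rational. Every instruction and every test costs one step. -/

/-- Read-only input. -/
structure RInput where
  ints : ℕ → ℕ
  reals : ℕ → ℝ

/-- Memory contents, output, and position on the random tape. -/
structure RState where
  imem : ℕ → ℕ
  rmem : ℕ → ℝ
  out : ℕ → ℝ
  pos : ℕ

/-- The state in which every computation starts. -/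
def RState.start : RState := ⟨fun _ => 0, fun _ => 0, fun _ => 0, 0⟩

/-- Instructions. `d`, `a`, `b` are addresses; `I`, `X` denote integer and real memory. -/
inductive RInstr where
  /-- `I[d] := k` -/
  | iconst (d k : ℕ)
  /-- `I[d] := I[a] + I[b]` -/
  | iadd (d a b : ℕ)
  /-- `I[d] := max (I[a] - I[b]) 0` -/
  | isub (d a b : ℕ)
  /-- `I[d] := I[I[a]]` -/
  | iload (d a : ℕ)
  /-- `I[I[a]] := I[b]` -/
  | istore (a b : ℕ)
  /-- `I[d] :=` integer input cell number `I[a]` -/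
  | iread (d a : ℕ)
  /-- `X[d] := q` -/
  | rconst (d : ℕ) (q : ℚ)
  /-- `X[d] := X[a] + X[b]` -/
  | radd (d a b : ℕ)
  /-- `X[d] := X[a] - X[b]` -/
  | rsub (d a b : ℕ)
  /-- `X[d] := X[a] * X[b]` -/
  | rmul (d a b : ℕ)
  /-- `X[d] := X[a] / X[b]` (and `0` when `X[b] = 0`) -/
  | rdiv (d a b : ℕ)
  /-- `X[d] := X[I[a]]` -/
  | rload (d a : ℕ)
  /-- `X[I[a]] := X[b]` -/
  | rstore (a b : ℕ)
  /-- `X[d] :=` real input cell number `I[a]` -/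
  | rread (d a : ℕ)
  /-- `X[d] := I[a]` -/
  | cast (d a : ℕ)
  /-- output cell number `I[a]` `:= X[b]` -/
  | write (a b : ℕ)
  /-- `I[d] :=` the next random bit -/
  | flip (d : ℕ)

/-- Effect of an instruction, on input `x` and with random tape `ω`. -/
def RInstr.exec (x : RInput) (ω : ℕ → Bool) : RInstr → RState → RState
  | iconst d k, s => { s with imem := Function.update s.imem d k }
  | iadd d a b, s => { s with imem := Function.update s.imem d (s.imem a + s.imem b) }
  | isub d a b, s => { s with imem := Function.update s.imem d (s.imem a - s.imem b) }
  | iload d a, s => { s with imem := Function.update s.imem d (s.imem (s.imem a)) }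
  | istore a b, s => { s with imem := Function.update s.imem (s.imem a) (s.imem b) }
  | iread d a, s => { s with imem := Function.update s.imem d (x.ints (s.imem a)) }
  | rconst d q, s => { s with rmem := Function.update s.rmem d (q : ℝ) }
  | radd d a b, s => { s with rmem := Function.update s.rmem d (s.rmem a + s.rmem b) }
  | rsub d a b, s => { s with rmem := Function.update s.rmem d (s.rmem a - s.rmem b) }
  | rmul d a b, s => { s with rmem := Function.update s.rmem d (s.rmem a * s.rmem b) }
  | rdiv d a b, s => { s with rmem := Function.update s.rmem d (s.rmem a / s.rmem b) }
  | rload d a, s => { s with rmem := Function.update s.rmem d (s.rmem (s.imem a)) }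
  | rstore a b, s => { s with rmem := Function.update s.rmem (s.imem a) (s.rmem b) }
  | rread d a, s => { s with rmem := Function.update s.rmem d (x.reals (s.imem a)) }
  | cast d a, s => { s with rmem := Function.update s.rmem d (s.imem a : ℝ) }
  | write a b, s => { s with out := Function.update s.out (s.imem a) (s.rmem b) }
  | flip d, s =>
      { s with imem := Function.update s.imem d (if ω s.pos then 1 else 0), pos := s.pos + 1 }

/-- Tests: `I[a] < I[b]` and `X[a] < X[b]`. -/
inductive RTest where
  | ilt (a b : ℕ)
  | rlt (a b : ℕ)

/-- When a test succeeds. -/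
def RTest.Holds (s : RState) : RTest → Prop
  | ilt a b => s.imem a < s.imem b
  | rlt a b => s.rmem a < s.rmem b

/-- Programs: instructions, sequencing, branching and while-loops. -/
inductive RProg where
  | instr (c : RInstr)
  | seq (p q : RProg)
  | branch (b : RTest) (p q : RProg)
  | loop (b : RTest) (p : RProg)

/-- `Runs x ω p s s' t`: on input `x` with random tape `ω`, the program `p` started in state `s`
halts in state `s'` after exactly `t` steps. -/
inductive RProg.Runs (x : RInput) (ω : ℕ → Bool) : RProg → RState → RState → ℕ → Prop
  | instr (c : RInstr) (s : RState) : Runs x ω (.instr c) s (c.exec x ω s) 1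
  | seq {p q : RProg} {s s' s'' : RState} {t t' : ℕ} (hp : Runs x ω p s s' t)
      (hq : Runs x ω q s' s'' t') : Runs x ω (.seq p q) s s'' (t + t')
  | branch_true {b : RTest} {p q : RProg} {s s' : RState} {t : ℕ} (hb : b.Holds s)
      (hp : Runs x ω p s s' t) : Runs x ω (.branch b p q) s s' (t + 1)
  | branch_false {b : RTest} {p q : RProg} {s s' : RState} {t : ℕ} (hb : ¬ b.Holds s)
      (hq : Runs x ω q s s' t) : Runs x ω (.branch b p q) s s' (t + 1)
  | loop_true {b : RTest} {p : RProg} {s s' s'' : RState} {t t' : ℕ} (hb : b.Holds s)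
      (hp : Runs x ω p s s' t) (hl : Runs x ω (.loop b p) s' s'' t') :
      Runs x ω (.loop b p) s s'' (t + t' + 1)
  | loop_false {b : RTest} {p : RProg} {s : RState} (hb : ¬ b.Holds s) :
      Runs x ω (.loop b p) s s 1

/-- The machine is deterministic once the input and the random tape are fixed, so the final state
and the number of steps are well defined. -/
theorem RProg.Runs.unique {x : RInput} {ω : ℕ → Bool} {p : RProg} {s s₁ s₂ : RState} {t₁ t₂ : ℕ}
    (h₁ : RProg.Runs x ω p s s₁ t₁) (h₂ : RProg.Runs x ω p s s₂ t₂) : s₁ = s₂ ∧ t₁ = t₂ := by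
  induction h₁ generalizing s₂ t₂ with
  | instr c s => cases h₂; exact ⟨rfl, rfl⟩
  | seq _ _ ihp ihq =>
    cases h₂ with
    | seq hp hq =>
      obtain ⟨rfl, rfl⟩ := ihp hp
      obtain ⟨rfl, rfl⟩ := ihq hq
      exact ⟨rfl, rfl⟩
  | branch_true hb _ ih =>
    cases h₂ with
    | branch_true _ hp => obtain ⟨rfl, rfl⟩ := ih hp; exact ⟨rfl, rfl⟩
    | branch_false hb' _ => exact absurd hb hb'
  | branch_false hb _ ih =>
    cases h₂ with
    | branch_true hb' _ => exact absurd hb' hb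
    | branch_false _ hp => obtain ⟨rfl, rfl⟩ := ih hp; exact ⟨rfl, rfl⟩
  | loop_true hb _ _ ihp ihl =>
    cases h₂ with
    | loop_true _ hp hl =>
      obtain ⟨rfl, rfl⟩ := ihp hp
      obtain ⟨rfl, rfl⟩ := ihl hl
      exact ⟨rfl, rfl⟩
    | loop_false hb' => exact absurd hb hb'
  | loop_false hb =>
    cases h₂ with
    | loop_true hb' _ _ => exact absurd hb' hb
    | loop_false _ => exact ⟨rfl, rfl⟩

/-- The law of the random tape: independent fair bits. -/
def coinLaw : Measure (ℕ → Bool) :=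
  Measure.infinitePi fun _ : ℕ => (PMF.uniformOfFintype Bool).toMeasure

/-- The entries of a matrix, row by row, each as its real part followed by its imaginary part. -/
def matrixEntries {r : ℕ} (M : QMat r) : List ℝ :=
  (List.ofFn fun a : Fin (2 ^ r) =>
    (List.ofFn fun b : Fin (2 ^ r) =>
      [(M (finFunctionFinEquiv.symm a) (finFunctionFinEquiv.symm b)).re,
        (M (finFunctionFinEquiv.symm a) (finFunctionFinEquiv.symm b)).im]).flatten).flatten

/-- The input `(H, ε)` as presented to the machine: the integer cells hold `n`, `m`, and then the
qubits of the terms `0, 1, …, m - 1`; the real cells hold `ε` and then the matrices of the terms.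
All later cells hold `0`. -/
def LocalHamiltonian.toInput {n m r : ℕ} (H : LocalHamiltonian n m r) (ε : ℝ) : RInput where
  ints k := (n :: m ::
    (List.ofFn fun i => List.ofFn fun j => (H.qubits i j : ℕ)).flatten).getD k 0
  reals k := (ε :: (List.ofFn fun i => matrixEntries (H.pred i)).flatten).getD k 0

/-- The weight function left in the first `m` output cells. -/
def RState.weights (s : RState) (m : ℕ) : Fin m → ℝ := fun i => s.out i

end

/-! The mean `E` of `D` is positive definite: if `⟨φ, E φ⟩ = 0`, then `M φ = 0` almost surely, so
`φ` is orthogonal to the column span of `M`, in particular to one of the `vᵢ`, which absolute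
continuity forbids (`IsPredicateLaw.exists_bounds`). Hence the mean Hamiltonian is at least `c m ·
Id`, with `c > 0` depending on `D` only, while each term has norm at most `B`. Once `m` is a large
multiple of `n`, the random Hamiltonian is within `c m / 2` of its mean in operator norm, so it is
at least `(c m / 2) · Id`. Relative approximation of energies then follows from additive
approximation in norm up to `ε c m / 2` (`isSparsifier_of_norm_le`).

Uniform sampling achieves that: cut the terms into consecutive blocks of length `2 ^ L`, about `m ε²
/ (C n)`, and keep one uniform term per block with weight `2 ^ L`. This is unbiased and leaves `O(n
/ ε²)` terms, with no logarithm. If `m ≤ C n / ε²` all terms are kept, and if `ε ≥ 1` zero weights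
suffice.

Both norm estimates come from one tail bound for sums of independent bounded Hermitian matrices
(`MatrixMoment.measure_norm_sum_gt_le`), proved by a recursion on trace moments: resample one
summand and apply a mean value inequality for the trace. Taking the moment of order `2 n`, the
dimension `2 ^ n` is beaten by `8 ^ (-n)`. An explicit program, `samplingProgram`, carries out the
sampling. -/

noncomputable section

/-! ### Trace inequalities for Hermitian matrices. -/

namespace MatrixMoment

open Matrix
open scoped Matrix.Norms.L2Operator

variable {ι : Type*} [Fintype ι] [DecidableEq ι]

/-- A Hermitian matrix is unitarily diagonalizable. -/
theorem exists_diagonalization {X : Matrix ι ι ℂ} (hX : X.IsHermitian) :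
    ∃ (U : Matrix.unitaryGroup ι ℂ) (x : ι → ℝ), ∀ a : ℕ,
      X ^ a = (U : Matrix ι ι ℂ) * diagonal (fun i => ((x i ^ a : ℝ) : ℂ)) *
        star (U : Matrix ι ι ℂ) := by
  refine ⟨hX.eigenvectorUnitary, hX.eigenvalues, fun a => ?_⟩
  conv_lhs => rw [hX.spectral_theorem]
  rw [← map_pow, diagonal_pow, Unitary.conjStarAlgAut_apply]
  congr 3
  ext i
  simp

/-- Joint spectral decomposition of the mixed moments of two Hermitian matrices. -/
theorem exists_mixed_moments {X Y : Matrix ι ι ℂ} (hX : X.IsHermitian) (hY : Y.IsHermitian) :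
    ∃ (c : ι → ι → ℝ) (x y : ι → ℝ), (∀ i j, 0 ≤ c i j) ∧ ∀ a b : ℕ,
      (trace (X ^ a * Y ^ b)).re = ∑ i, ∑ j, c i j * (x i ^ a * y j ^ b) := by
  obtain ⟨U, x, hU⟩ := exists_diagonalization hX
  obtain ⟨V, y, hV⟩ := exists_diagonalization hY
  -- `O` is the overlap of the two eigenbases and the weights are `|O i j|²`. Trace inequalities
  -- linear in the mixed moments thus reduce to inequalities between real numbers.
  set O : Matrix ι ι ℂ := star (U : Matrix ι ι ℂ) * V with hO
  have hO' : star O = star (V : Matrix ι ι ℂ) * U := by simp [hO]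
  refine ⟨fun i j => Complex.normSq (O i j), x, y, fun i j => Complex.normSq_nonneg _,
    fun a b => ?_⟩
  have h1 : trace (X ^ a * Y ^ b) = trace (diagonal (fun i => ((x i ^ a : ℝ) : ℂ)) * O *
      diagonal (fun i => ((y i ^ b : ℝ) : ℂ)) * star O) := by
    rw [hU, hV, hO', hO]
    simp only [Matrix.mul_assoc]
    rw [trace_mul_comm]
    simp only [Matrix.mul_assoc]
  rw [h1]
  simp only [trace, diag_apply, Complex.re_sum]
  simp_rw [mul_apply (N := star O), mul_diagonal, diagonal_mul, star_apply, Complex.re_sum]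
  refine Finset.sum_congr rfl fun i _ => Finset.sum_congr rfl fun j _ => ?_
  have : (starRingEnd ℂ) (O i j) * O i j = (Complex.normSq (O i j) : ℂ) :=
    Complex.normSq_eq_conj_mul_self.symm
  have h2 : ((x i ^ a : ℝ) : ℂ) * O i j * ((y j ^ b : ℝ) : ℂ) * star (O i j)
      = ((Complex.normSq (O i j) * (x i ^ a * y j ^ b) : ℝ) : ℂ) := by
    push_cast
    rw [← this, Complex.star_def]
    ring
  rw [h2, Complex.ofReal_re]

/-- The scalar inequality behind the trace mean value inequality. -/
theorem sub_mul_pow_sub_pow_le (x y : ℝ) (p : ℕ) :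
    (x - y) * (x ^ (2 * p + 1) - y ^ (2 * p + 1)) ≤
      (2 * p + 1) / 2 * ((x - y) ^ 2 * (x ^ (2 * p) + y ^ (2 * p))) := by
  have h := (Commute.all x y).geom_sum₂_mul (2 * p + 1)
  rw [← h]
  have key : ∑ i ∈ Finset.range (2 * p + 1), x ^ i * y ^ (2 * p + 1 - 1 - i) ≤
      (2 * p + 1) / 2 * (x ^ (2 * p) + y ^ (2 * p)) := by
    have h1 : 2 * ∑ i ∈ Finset.range (2 * p + 1), x ^ i * y ^ (2 * p + 1 - 1 - i) ≤
        ∑ i ∈ Finset.range (2 * p + 1), (x ^ (2 * p) + y ^ (2 * p)) := by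
      -- Pair each summand with its reflection: `x^i y^j + x^j y^i ≤ x^(2p) + y^(2p)` for `i + j =
      -- 2p`, by rearrangement of `|x|` and `|y|`; the even total degree permits the absolute
      -- values.
      have h2 := Finset.sum_range_reflect
        (fun i => x ^ i * y ^ (2 * p + 1 - 1 - i)) (2 * p + 1)
      rw [two_mul]
      nth_rewrite 1 [← h2]
      rw [← Finset.sum_add_distrib]
      refine Finset.sum_le_sum fun i hi => ?_
      have hi' : i ≤ 2 * p := by simpa [Nat.lt_succ_iff] using hi
      obtain ⟨j, hj⟩ := Nat.exists_eq_add_of_le hi'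
      have e1 : 2 * p + 1 - 1 - i = j := by omega
      have e2 : 2 * p + 1 - 1 - j = i := by omega
      rw [e1, e2]
      have ev : Even (i + j) := ⟨p, by omega⟩
      rw [hj]
      have hx : x ^ (i + j) = |x| ^ i * |x| ^ j := by rw [← pow_add, ev.pow_abs]
      have hy : y ^ (i + j) = |y| ^ i * |y| ^ j := by rw [← pow_add, ev.pow_abs]
      have b1 : x ^ j * y ^ i ≤ |x| ^ j * |y| ^ i := by
        rw [← abs_pow, ← abs_pow, ← abs_mul]; exact le_abs_self _
      have b2 : x ^ i * y ^ j ≤ |x| ^ i * |y| ^ j := by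
        rw [← abs_pow, ← abs_pow, ← abs_mul]; exact le_abs_self _
      have b3 : 0 ≤ (|x| ^ i - |y| ^ i) * (|x| ^ j - |y| ^ j) := by
        rcases le_total |x| |y| with h | h
        · exact mul_nonneg_of_nonpos_of_nonpos
            (sub_nonpos.2 (pow_le_pow_left₀ (abs_nonneg _) h _))
            (sub_nonpos.2 (pow_le_pow_left₀ (abs_nonneg _) h _))
        · exact mul_nonneg
            (sub_nonneg.2 (pow_le_pow_left₀ (abs_nonneg _) h _))
            (sub_nonneg.2 (pow_le_pow_left₀ (abs_nonneg _) h _))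
      rw [hx, hy]
      nlinarith
    rw [Finset.sum_const, Finset.card_range, nsmul_eq_mul] at h1
    push_cast at h1
    rw [Nat.add_sub_cancel]
    linarith
  have := mul_le_mul_of_nonneg_left key (sq_nonneg (x - y))
  linarith

theorem trace_pow_nonneg {X : Matrix ι ι ℂ} (hX : X.IsHermitian) (p : ℕ) :
    0 ≤ (trace (X ^ (2 * p))).re := by
  obtain ⟨c, x, y, hc, h⟩ := exists_mixed_moments hX hX
  have := h (2 * p) 0
  rw [pow_zero, mul_one] at this
  rw [this]
  refine Finset.sum_nonneg fun i _ => Finset.sum_nonneg fun j _ => mul_nonneg (hc i j) ?_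
  rw [pow_zero, mul_one, pow_mul]
  positivity

/-- Mean value inequality for the trace. -/
theorem trace_sub_mul_pow_sub_pow_le {X Y : Matrix ι ι ℂ} (hX : X.IsHermitian)
    (hY : Y.IsHermitian) (p : ℕ) :
    (trace ((X - Y) * (X ^ (2 * p + 1) - Y ^ (2 * p + 1)))).re ≤
      (2 * p + 1) / 2 * ((trace ((X - Y) ^ 2 * X ^ (2 * p))).re +
        (trace ((X - Y) ^ 2 * Y ^ (2 * p))).re) := by
  obtain ⟨c, x, y, hc, h⟩ := exists_mixed_moments hX hY
  -- Cyclicity of the trace brings every word to the form `X ^ a * Y ^ b`.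
  have e1 : trace ((X - Y) * (X ^ (2 * p + 1) - Y ^ (2 * p + 1))) =
      trace (X ^ (2 * p + 2) * Y ^ 0) - trace (X ^ 1 * Y ^ (2 * p + 1))
        - trace (X ^ (2 * p + 1) * Y ^ 1) + trace (X ^ 0 * Y ^ (2 * p + 2)) := by
    rw [trace_mul_comm (X ^ (2 * p + 1)) (Y ^ 1)]
    simp only [sub_mul, mul_sub, trace_sub, pow_zero, pow_one, mul_one, one_mul, ← pow_succ']
    ring
  have e2 : trace ((X - Y) ^ 2 * X ^ (2 * p)) = trace (X ^ (2 * p + 2) * Y ^ 0)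
      - 2 * trace (X ^ (2 * p + 1) * Y ^ 1) + trace (X ^ (2 * p) * Y ^ 2) := by
    have a1 : trace (X * Y * X ^ (2 * p)) = trace (X ^ (2 * p + 1) * Y) := by
      rw [trace_mul_comm, ← mul_assoc, ← pow_succ]
    have a2 : trace (Y * X * X ^ (2 * p)) = trace (X ^ (2 * p + 1) * Y) := by
      rw [mul_assoc, trace_mul_comm, ← pow_succ']
    have a3 : trace (Y * Y * X ^ (2 * p)) = trace (X ^ (2 * p) * Y ^ 2) := by
      rw [trace_mul_comm, sq]
    have a4 : X * X * X ^ (2 * p) = X ^ (2 * p + 2) := by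
      rw [← sq, ← pow_add, add_comm]
    simp only [sq, sub_mul, mul_sub, trace_sub, pow_zero, pow_one, mul_one, a1, a2, a3, a4]
    ring
  have e3 : trace ((X - Y) ^ 2 * Y ^ (2 * p)) = trace (X ^ 2 * Y ^ (2 * p))
      - 2 * trace (X ^ 1 * Y ^ (2 * p + 1)) + trace (X ^ 0 * Y ^ (2 * p + 2)) := by
    have a1 : trace (X * Y * Y ^ (2 * p)) = trace (X * Y ^ (2 * p + 1)) := by
      rw [mul_assoc, ← pow_succ']
    have a2 : trace (Y * X * Y ^ (2 * p)) = trace (X * Y ^ (2 * p + 1)) := by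
      rw [mul_assoc, trace_mul_comm, mul_assoc, ← pow_succ]
    have a4 : Y * Y * Y ^ (2 * p) = Y ^ (2 * p + 2) := by
      rw [← sq, ← pow_add, add_comm]
    simp only [sq, sub_mul, mul_sub, trace_sub, pow_zero, pow_one, one_mul, a1, a2, a4]
    ring
  rw [e1, e2, e3]
  simp only [Complex.add_re, Complex.sub_re, Complex.mul_re, Complex.re_ofNat, Complex.im_ofNat,
    zero_mul, sub_zero, h, Finset.mul_sum, ← Finset.sum_add_distrib, ← Finset.sum_sub_distrib]
  refine Finset.sum_le_sum fun i _ => Finset.sum_le_sum fun j _ => ?_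
  have := mul_le_mul_of_nonneg_left (sub_mul_pow_sub_pow_le (x i) (y j) p) (hc i j)
  refine le_trans (le_of_eq ?_) (this.trans (le_of_eq ?_)) <;> ring

theorem trace_conjTranspose_mul_self_re {κ : Type*} [Fintype κ] (A : Matrix κ κ ℂ) :
    (trace (Aᴴ * A)).re = ∑ j, ‖WithLp.toLp 2 (A.col j)‖ ^ 2 := by
  simp only [trace, diag_apply, mul_apply, conjTranspose_apply, Complex.re_sum,
    EuclideanSpace.norm_sq_eq]
  refine Finset.sum_congr rfl fun i _ => Finset.sum_congr rfl fun j _ => ?_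
  rw [Complex.star_def, ← Complex.normSq_eq_conj_mul_self, Complex.ofReal_re,
    Complex.normSq_eq_norm_sq]
  rfl

/-- The left side is the squared Hilbert–Schmidt norm of `W * X ^ p`, and `W` stretches each column
of `X ^ p` by at most `Δ`. -/
theorem trace_sq_mul_pow_le {W X : Matrix ι ι ℂ} (hW : W.IsHermitian) (hX : X.IsHermitian)
    {Δ : ℝ} (hΔ : ‖W‖ ≤ Δ) (p : ℕ) :
    (trace (W ^ 2 * X ^ (2 * p))).re ≤ Δ ^ 2 * (trace (X ^ (2 * p))).re := by
  have hXp : (X ^ p)ᴴ = X ^ p := by rw [conjTranspose_pow, hX.eq]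
  have e1 : trace (W ^ 2 * X ^ (2 * p)) = trace ((W * X ^ p)ᴴ * (W * X ^ p)) := by
    rw [conjTranspose_mul, hXp, hW.eq, two_mul, pow_add, sq]
    simp only [← mul_assoc]
    rw [trace_mul_comm]
    simp only [← mul_assoc]
  have e2 : X ^ (2 * p) = (X ^ p)ᴴ * X ^ p := by rw [hXp, two_mul, pow_add]
  rw [e1, e2, trace_conjTranspose_mul_self_re, trace_conjTranspose_mul_self_re, Finset.mul_sum]
  refine Finset.sum_le_sum fun j _ => ?_
  have h := l2_opNorm_mulVec W (WithLp.toLp 2 ((X ^ p).col j))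
  have h' : ‖WithLp.toLp 2 ((W * X ^ p).col j)‖ ≤ Δ * ‖WithLp.toLp 2 ((X ^ p).col j)‖ :=
    le_trans h (mul_le_mul_of_nonneg_right hΔ (norm_nonneg _))
  calc _ ≤ (Δ * ‖WithLp.toLp 2 ((X ^ p).col j)‖) ^ 2 :=
        pow_le_pow_left₀ (norm_nonneg _) h' 2
    _ = _ := mul_pow _ _ _

theorem trace_sub_mul_pow_sub_pow_le_norm {X Y : Matrix ι ι ℂ} (hX : X.IsHermitian)
    (hY : Y.IsHermitian) {Δ : ℝ} (hΔ : ‖X - Y‖ ≤ Δ) (p : ℕ) :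
    (trace ((X - Y) * (X ^ (2 * p + 1) - Y ^ (2 * p + 1)))).re ≤
      (2 * p + 1) / 2 * Δ ^ 2 * ((trace (X ^ (2 * p))).re + (trace (Y ^ (2 * p))).re) := by
  refine (trace_sub_mul_pow_sub_pow_le hX hY p).trans ?_
  have h1 := trace_sq_mul_pow_le (hX.sub hY) hX hΔ p
  have h2 := trace_sq_mul_pow_le (hX.sub hY) hY hΔ p
  rw [mul_assoc]
  refine mul_le_mul_of_nonneg_left ?_ (by positivity)
  linarith

/-- The trace of an even power is a sum of nonnegative powers of eigenvalues, so it dominates each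
of them. -/
theorem norm_le_of_trace_pow_le {X : Matrix ι ι ℂ} (hX : X.IsHermitian) {p : ℕ} (hp : p ≠ 0)
    {t : ℝ} (ht : 0 ≤ t) (h : (trace (X ^ (2 * p))).re ≤ t ^ (2 * p)) : ‖X‖ ≤ t := by
  obtain ⟨U, x, hU⟩ := exists_diagonalization hX
  have h1 := hU 1
  rw [pow_one] at h1
  rw [h1, ← Unitary.coe_star, CStarRing.norm_mul_coe_unitary, CStarRing.norm_coe_unitary_mul,
    l2_opNorm_diagonal, pi_norm_le_iff_of_nonneg ht]
  intro i
  rw [hU, trace_mul_comm, ← mul_assoc, Unitary.coe_star_mul_self, one_mul, trace_diagonal,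
    Complex.re_sum] at h
  simp only [Complex.ofReal_re] at h
  have h2 : x i ^ (2 * p) ≤ t ^ (2 * p) := by
    refine le_trans (Finset.single_le_sum (f := fun i => x i ^ (2 * p)) (fun j _ => ?_)
      (Finset.mem_univ i)) h
    rw [pow_mul]; positivity
  rw [pow_one, Complex.norm_real, Real.norm_eq_abs]
  rw [← (even_two_mul p).pow_abs] at h2
  exact le_of_pow_le_pow_left₀ (by omega) ht h2

end MatrixMoment

end

/-! ### Moments and tails of sums of independent random Hermitian matrices. -/

noncomputable section

namespace MatrixMoment

open Matrix
open scoped Matrix.Norms.L2Operator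

variable {ι : Type*} [Fintype ι] [DecidableEq ι] {α β κ : Type*} [MeasurableSpace α]
  [MeasurableSpace β]

/-- Bounded, strongly measurable random matrices. -/
structure BddMeas (f : α → Matrix ι ι ℂ) : Prop where
  meas : StronglyMeasurable f
  bdd : ∃ C, ∀ a, ‖f a‖ ≤ C

namespace BddMeas

variable {f g : α → Matrix ι ι ℂ}

theorem const (A : Matrix ι ι ℂ) : BddMeas fun _ : α => A :=
  ⟨stronglyMeasurable_const, ‖A‖, fun _ => le_rfl⟩

theorem add (hf : BddMeas f) (hg : BddMeas g) : BddMeas fun a => f a + g a := by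
  obtain ⟨C, hC⟩ := hf.bdd
  obtain ⟨C', hC'⟩ := hg.bdd
  exact ⟨hf.meas.add hg.meas, C + C', fun a => norm_add_le_of_le (hC a) (hC' a)⟩

theorem sub (hf : BddMeas f) (hg : BddMeas g) : BddMeas fun a => f a - g a := by
  obtain ⟨C, hC⟩ := hf.bdd
  obtain ⟨C', hC'⟩ := hg.bdd
  exact ⟨hf.meas.sub hg.meas, C + C', fun a => norm_sub_le_of_le (hC a) (hC' a)⟩

theorem mul (hf : BddMeas f) (hg : BddMeas g) : BddMeas fun a => f a * g a := by
  obtain ⟨C, hC⟩ := hf.bdd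
  obtain ⟨C', hC'⟩ := hg.bdd
  exact ⟨hf.meas.mul hg.meas, C * C', fun a => norm_mul_le_of_le (hC a) (hC' a)⟩

theorem pow (hf : BddMeas f) (p : ℕ) : BddMeas fun a => f a ^ p := by
  induction p with
  | zero => simpa using const 1
  | succ p ih => simpa only [pow_succ] using ih.mul hf

theorem sum {s : Finset κ} {f : κ → α → Matrix ι ι ℂ} (hf : ∀ i, BddMeas (f i)) :
    BddMeas fun a => ∑ i ∈ s, f i a := by
  classical
  induction s using Finset.induction_on with
  | empty => simpa using const 0
  | insert i s hi ih => simpa only [Finset.sum_insert hi] using (hf i).add ih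

theorem comp (hf : BddMeas f) {φ : β → α} (hφ : Measurable φ) : BddMeas fun b => f (φ b) := by
  obtain ⟨C, hC⟩ := hf.bdd
  exact ⟨hf.meas.comp_measurable hφ, C, fun b => hC _⟩

theorem integrable (hf : BddMeas f) (μ : Measure α) [IsFiniteMeasure μ] : Integrable f μ := by
  obtain ⟨C, hC⟩ := hf.bdd
  exact Integrable.of_bound hf.meas.aestronglyMeasurable C (ae_of_all _ hC)

end BddMeas

/-- The real part of the trace, as a continuous functional. -/
def traceRe : Matrix ι ι ℂ →L[ℝ] ℝ :=
  LinearMap.toContinuousLinearMap (Complex.reLm ∘ₗ (traceLinearMap ι ℂ ℂ).restrictScalars ℝ)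

theorem BddMeas.integrable_trace {f : α → Matrix ι ι ℂ} (hf : BddMeas f) (μ : Measure α)
    [IsFiniteMeasure μ] : Integrable (fun a => (trace (f a)).re) μ :=
  traceRe.integrable_comp (hf.integrable μ)

theorem integral_trace_mul_left {f : α → Matrix ι ι ℂ} (hf : BddMeas f) (μ : Measure α)
    [IsFiniteMeasure μ] (A : Matrix ι ι ℂ) :
    ∫ a, (trace (A * f a)).re ∂μ = (trace (A * ∫ a, f a ∂μ)).re :=
  (traceRe ∘L (ContinuousLinearMap.mul ℝ (Matrix ι ι ℂ) A)).integral_comp_comm (hf.integrable μ)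

theorem integral_trace_mul_right {f : α → Matrix ι ι ℂ} (hf : BddMeas f) (μ : Measure α)
    [IsFiniteMeasure μ] (A : Matrix ι ι ℂ) :
    ∫ a, (trace (f a * A)).re ∂μ = (trace ((∫ a, f a ∂μ) * A)).re := by
  simp_rw [trace_mul_comm _ A]
  exact integral_trace_mul_left hf μ A

/-- One step of the moment recursion, conditionally on the other summands. -/
theorem integral_trace_mul_pow_le (μ : Measure α) [IsProbabilityMeasure μ]
    {Z : α → Matrix ι ι ℂ} (hZ : BddMeas Z) (hH : ∀ a, (Z a).IsHermitian)
    (h0 : ∫ a, Z a ∂μ = 0) {Δ : ℝ} (hΔ : ∀ a b, ‖Z a - Z b‖ ≤ Δ) {R : Matrix ι ι ℂ}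
    (hR : R.IsHermitian) (p : ℕ) :
    ∫ a, (trace (Z a * (R + Z a) ^ (2 * p + 1))).re ∂μ ≤
      (2 * p + 1) / 2 * Δ ^ 2 * ∫ a, (trace ((R + Z a) ^ (2 * p))).re ∂μ := by
  have hX : BddMeas fun a => R + Z a := (BddMeas.const R).add hZ
  have hXp := hX.pow (2 * p + 1)
  have hf := (hZ.mul hXp).integrable_trace μ
  have hh := (hX.pow (2 * p)).integrable_trace μ
  set F := ∫ a, (trace (Z a * (R + Z a) ^ (2 * p + 1))).re ∂μ with hF
  set T := ∫ a, (trace ((R + Z a) ^ (2 * p))).re ∂μ with hT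
  set P := ∫ a, (R + Z a) ^ (2 * p + 1) ∂μ with hP
  -- Symmetrization with an independent copy `b` of `a`. Averaging over `a` kills the cross term `Z
  -- a * (R + Z b) ^ (2p+1)`, because `Z` is centered.
  have inner : ∀ b, F - (trace (Z b * P)).re + (trace (Z b * (R + Z b) ^ (2 * p + 1))).re ≤
      (2 * p + 1) / 2 * Δ ^ 2 * (T + (trace ((R + Z b) ^ (2 * p))).re) := by
    intro b
    have i2 := (hZ.mul (BddMeas.const ((R + Z b) ^ (2 * p + 1)))).integrable_trace μ
    have i3 := ((BddMeas.const (Z b)).mul hXp).integrable_trace μ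
    have e : F - (trace (Z b * P)).re + (trace (Z b * (R + Z b) ^ (2 * p + 1))).re =
        ∫ a, (trace ((Z a - Z b) * ((R + Z a) ^ (2 * p + 1) -
          (R + Z b) ^ (2 * p + 1)))).re ∂μ := by
      have e1 : ∀ a, (trace ((Z a - Z b) * ((R + Z a) ^ (2 * p + 1) -
          (R + Z b) ^ (2 * p + 1)))).re = (trace (Z a * (R + Z a) ^ (2 * p + 1))).re
          - (trace (Z a * (R + Z b) ^ (2 * p + 1))).re
          - (trace (Z b * (R + Z a) ^ (2 * p + 1))).re
          + (trace (Z b * (R + Z b) ^ (2 * p + 1))).re := by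
        intro a
        simp only [sub_mul, mul_sub, trace_sub, Complex.sub_re]
        ring
      have j1 : Integrable (fun a => (trace (Z a * (R + Z a) ^ (2 * p + 1))).re
          - (trace (Z a * (R + Z b) ^ (2 * p + 1))).re) μ := hf.sub i2
      have j2 : Integrable (fun a => (trace (Z a * (R + Z a) ^ (2 * p + 1))).re
          - (trace (Z a * (R + Z b) ^ (2 * p + 1))).re
          - (trace (Z b * (R + Z a) ^ (2 * p + 1))).re) μ := j1.sub i3
      simp_rw [e1]
      rw [integral_add j2 (integrable_const _), integral_sub j1 i3, integral_sub hf i2, integral_trace_mul_right hZ,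
        integral_trace_mul_left hXp, h0, zero_mul, trace_zero, integral_const]
      simp [hF, hP]
    rw [e]
    have e2 : T + (trace ((R + Z b) ^ (2 * p))).re =
        ∫ a, ((trace ((R + Z a) ^ (2 * p))).re + (trace ((R + Z b) ^ (2 * p))).re) ∂μ := by
      rw [integral_add hh (integrable_const _), integral_const]
      simp [hT]
    rw [e2, ← integral_const_mul]
    refine integral_mono ?_ ((hh.add (integrable_const _)).const_mul _) fun a => ?_
    · exact ((hZ.sub (BddMeas.const _)).mul (hXp.sub (BddMeas.const _))).integrable_trace μ
    · have := trace_sub_mul_pow_sub_pow_le_norm (hR.add (hH a)) (hR.add (hH b)) (Δ := Δ)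
        (by simpa using hΔ a b) p
      simpa using this
  have i4 := (hZ.mul (BddMeas.const P)).integrable_trace μ
  have j3 : Integrable (fun b => F - (trace (Z b * P)).re) μ := (integrable_const F).sub i4
  have j4 : Integrable (fun b => F - (trace (Z b * P)).re +
      (trace (Z b * (R + Z b) ^ (2 * p + 1))).re) μ := j3.add hf
  have j5 : Integrable (fun b => T + (trace ((R + Z b) ^ (2 * p))).re) μ :=
    (integrable_const T).add hh
  -- Averaging over `b` kills the other cross term and leaves `2F` against `2T`, so the factor
  -- `(2p+1)/2 * Δ ^ 2` survives unchanged.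
  have outer := integral_mono j4 (j5.const_mul ((2 * p + 1) / 2 * Δ ^ 2)) inner
  rw [integral_const_mul, integral_add j3 hf, integral_sub (integrable_const F) i4,
    integral_add (integrable_const T) hh, integral_trace_mul_right hZ, h0, ← hF, ← hT] at outer
  simp only [integral_const, probReal_univ, one_smul, zero_mul, trace_zero, Complex.zero_re,
    sub_zero] at outer
  linarith

/-- Resampling one coordinate preserves a product measure. -/
theorem measurePreserving_update [Fintype κ] [DecidableEq κ] (μ : Measure α)
    [IsProbabilityMeasure μ] (i : κ) :
    MeasurePreserving (fun q : (κ → α) × α => Function.update q.1 i q.2)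
      ((Measure.pi fun _ : κ => μ).prod μ) (Measure.pi fun _ : κ => μ) := by
  have hm : Measurable fun q : (κ → α) × α => Function.update q.1 i q.2 := by
    refine measurable_pi_lambda _ fun j => ?_
    by_cases h : j = i
    · subst h; simpa using measurable_snd
    · simp only [Function.update_of_ne h]
      exact (measurable_pi_apply j).comp measurable_fst
  refine ⟨hm, ?_⟩
  symm
  refine Measure.pi_eq fun s hs => ?_
  rw [Measure.map_apply hm (MeasurableSet.univ_pi hs)]
  have : (fun q : (κ → α) × α => Function.update q.1 i q.2) ⁻¹' (Set.univ.pi s) =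
      (Set.univ.pi (Function.update s i Set.univ)) ×ˢ s i := by
    ext q
    simp only [Set.mem_preimage, Set.mem_pi, Set.mem_univ, true_implies, Set.mem_prod]
    constructor
    · intro h
      refine ⟨fun j => ?_, by simpa using h i⟩
      by_cases hj : j = i
      · subst hj; simp
      · simpa [Function.update_of_ne hj] using h j
    · rintro ⟨h, h'⟩ j
      by_cases hj : j = i
      · subst hj; simpa using h'
      · simpa [Function.update_of_ne hj] using h j
  rw [this, Measure.prod_prod, Measure.pi_pi, ← Finset.mul_prod_erase _ _ (Finset.mem_univ i),
    ← Finset.mul_prod_erase Finset.univ (fun j => μ (s j)) (Finset.mem_univ i)]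
  simp only [Function.update_self, measure_univ, one_mul]
  rw [mul_comm]
  congr 1
  refine Finset.prod_congr rfl fun j hj => ?_
  rw [Function.update_of_ne (Finset.ne_of_mem_erase hj)]

theorem integral_trace_resample [Fintype κ] [DecidableEq κ] (μ : Measure α)
    [IsProbabilityMeasure μ] (i : κ) {f : (κ → α) → Matrix ι ι ℂ} (hf : BddMeas f) :
    ∫ ω, (trace (f ω)).re ∂(Measure.pi fun _ : κ => μ) =
      ∫ ω, ∫ a, (trace (f (Function.update ω i a))).re ∂μ ∂(Measure.pi fun _ : κ => μ) := by
  have hmp := measurePreserving_update (κ := κ) μ i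
  have hi := (hf.comp hmp.measurable).integrable_trace ((Measure.pi fun _ : κ => μ).prod μ)
  rw [← integral_prod _ hi]
  rw [← hmp.map_eq, integral_map hmp.measurable.aemeasurable]
  rw [hmp.map_eq]
  exact (hf.integrable_trace _).aestronglyMeasurable

section Sum

variable [Fintype κ] [DecidableEq κ] (μ : Measure α) [IsProbabilityMeasure μ]
  {Z : κ → α → Matrix ι ι ℂ}

/-- Write `X ^ (2p+2)` as the sum of the `Z i * X ^ (2p+1)`. In the `i`-th summand only coordinate
`i` is resampled, so the other terms act as the fixed matrix `R` of `integral_trace_mul_pow_le`. -/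
theorem moment_succ_le (hZ : ∀ i, BddMeas (Z i)) (hH : ∀ i a, (Z i a).IsHermitian)
    (h0 : ∀ i, ∫ a, Z i a ∂μ = 0) {Δ : ℝ} (hΔ : ∀ i a b, ‖Z i a - Z i b‖ ≤ Δ) (p : ℕ) :
    ∫ ω, (trace ((∑ i, Z i (ω i)) ^ (2 * (p + 1)))).re ∂(Measure.pi fun _ : κ => μ) ≤
      Fintype.card κ * ((2 * p + 1) / 2 * Δ ^ 2) *
        ∫ ω, (trace ((∑ i, Z i (ω i)) ^ (2 * p))).re ∂(Measure.pi fun _ : κ => μ) := by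
  have hZ' : ∀ i, BddMeas fun ω : κ → α => Z i (ω i) := fun i =>
    (hZ i).comp (measurable_pi_apply i)
  have hX : BddMeas fun ω : κ → α => ∑ i, Z i (ω i) := BddMeas.sum hZ'
  have e1 : ∀ ω : κ → α, (trace ((∑ i, Z i (ω i)) ^ (2 * (p + 1)))).re =
      ∑ i, (trace (Z i (ω i) * (∑ i, Z i (ω i)) ^ (2 * p + 1))).re := by
    intro ω
    rw [← Complex.re_sum, ← trace_sum, ← Finset.sum_mul, ← pow_succ']
    ring_nf
  simp_rw [e1]
  rw [integral_finsetSum _ fun i _ =>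
    ((hZ' i).mul (hX.pow (2 * p + 1))).integrable_trace _, mul_assoc, ← nsmul_eq_mul,
    ← Finset.card_univ, ← Finset.sum_const]
  refine Finset.sum_le_sum fun i _ => ?_
  have hsplit : ∀ (ω : κ → α) (a : α), ∑ j, Z j (Function.update ω i a j) =
      (∑ j ∈ Finset.univ.erase i, Z j (ω j)) + Z i a := by
    intro ω a
    rw [← Finset.add_sum_erase _ _ (Finset.mem_univ i), add_comm, Function.update_self]
    congr 1
    exact Finset.sum_congr rfl fun j hj => by
      rw [Function.update_of_ne (Finset.ne_of_mem_erase hj)]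
  rw [integral_trace_resample μ i ((hZ' i).mul (hX.pow (2 * p + 1))),
    integral_trace_resample μ i (hX.pow (2 * p)), ← integral_const_mul]
  have hmp := (measurePreserving_update (κ := κ) μ i).measurable
  refine integral_mono ?_ (Integrable.const_mul ?_ _) fun ω => ?_
  · exact ((((hZ' i).mul (hX.pow (2 * p + 1))).comp hmp).integrable_trace
      ((Measure.pi fun _ : κ => μ).prod μ)).integral_prod_left
  · exact (((hX.pow (2 * p)).comp hmp).integrable_trace
      ((Measure.pi fun _ : κ => μ).prod μ)).integral_prod_left
  · simp only [hsplit, Function.update_self]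
    exact integral_trace_mul_pow_le μ (hZ i) (hH i) (h0 i) (hΔ i)
      (isSelfAdjoint_sum _ fun j _ => hH j _) p

/-- Iteration of the recursion; the fixed `P` bounds every factor `(2p+1)/2` met on the way. -/
theorem moment_le (hZ : ∀ i, BddMeas (Z i)) (hH : ∀ i a, (Z i a).IsHermitian)
    (h0 : ∀ i, ∫ a, Z i a ∂μ = 0) {Δ : ℝ} (hΔ : ∀ i a b, ‖Z i a - Z i b‖ ≤ Δ) (P : ℕ) {p : ℕ}
    (hp : p ≤ P) :
    ∫ ω, (trace ((∑ i, Z i (ω i)) ^ (2 * p))).re ∂(Measure.pi fun _ : κ => μ) ≤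
      Fintype.card ι * (Fintype.card κ * P * Δ ^ 2) ^ p := by
  induction p with
  | zero => simp
  | succ p ih =>
    refine (moment_succ_le μ hZ hH h0 hΔ p).trans ?_
    have h1 := ih (by omega)
    have hp' : (p : ℝ) + 1 ≤ P := by exact_mod_cast hp
    have h2 : (Fintype.card κ : ℝ) * ((2 * p + 1) / 2 * Δ ^ 2) ≤ Fintype.card κ * P * Δ ^ 2 := by
      rw [mul_assoc]
      refine mul_le_mul_of_nonneg_left ?_ (Nat.cast_nonneg _)
      refine mul_le_mul_of_nonneg_right ?_ (sq_nonneg _)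
      linarith
    calc _ ≤ (Fintype.card κ : ℝ) * ((2 * p + 1) / 2 * Δ ^ 2) *
          (Fintype.card ι * (Fintype.card κ * P * Δ ^ 2) ^ p) :=
          mul_le_mul_of_nonneg_left h1 (by positivity)
      _ ≤ (Fintype.card κ * P * Δ ^ 2) * (Fintype.card ι * (Fintype.card κ * P * Δ ^ 2) ^ p) :=
          mul_le_mul_of_nonneg_right h2 (by positivity)
      _ = _ := by ring

/-- Tail bound for the norm of a sum of independent bounded random Hermitian matrices. -/
theorem measure_norm_sum_gt_le (hZ : ∀ i, BddMeas (Z i)) (hH : ∀ i a, (Z i a).IsHermitian)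
    {Δ : ℝ} (hΔ : ∀ i a b, ‖Z i a - Z i b‖ ≤ Δ) {p : ℕ} (hp : p ≠ 0) {t : ℝ} (ht : 0 < t) :
    (Measure.pi fun _ : κ => μ) {ω | t < ‖∑ i, Z i (ω i) - ∑ i, ∫ a, Z i a ∂μ‖} ≤
      ENNReal.ofReal (Fintype.card ι * (Fintype.card κ * p * Δ ^ 2 / t ^ 2) ^ p) := by
  -- Centering does not change differences, so the bound `Δ` is kept.
  set Y : κ → α → Matrix ι ι ℂ := fun i a => Z i a - ∫ a, Z i a ∂μ with hY
  have hYb : ∀ i, BddMeas (Y i) := fun i => (hZ i).sub (BddMeas.const _)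
  have hYH : ∀ i a, (Y i a).IsHermitian := by
    intro i a
    refine (hH i a).sub ?_
    have := (starL' ℝ (A := Matrix ι ι ℂ)).toContinuousLinearMap.integral_comp_comm
      ((hZ i).integrable μ)
    have h2 : ∀ a, (starL' ℝ (A := Matrix ι ι ℂ)) (Z i a) = Z i a := fun a => (hH i a).eq
    exact this.symm.trans (integral_congr_ae (ae_of_all _ h2))
  have hY0 : ∀ i, ∫ a, Y i a ∂μ = 0 := by
    intro i
    rw [hY, integral_sub ((hZ i).integrable μ) (integrable_const _)]
    simp
  have hYΔ : ∀ i a b, ‖Y i a - Y i b‖ ≤ Δ := by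
    intro i a b
    simpa [hY] using hΔ i a b
  have hm := moment_le μ hYb hYH hY0 hYΔ p le_rfl
  have hXb : BddMeas fun ω : κ → α => (∑ i, Y i (ω i)) ^ (2 * p) :=
    (BddMeas.sum fun i => (hYb i).comp (measurable_pi_apply i)).pow _
  -- Markov's inequality for the trace of the `2p`-th power, which controls the norm.
  have hmarkov := mul_meas_ge_le_integral_of_nonneg
    (μ := Measure.pi fun _ : κ => μ) (f := fun ω => (trace ((∑ i, Y i (ω i)) ^ (2 * p))).re)
    (ae_of_all _ fun ω => trace_pow_nonneg (isSelfAdjoint_sum _ fun i _ => hYH i _) p)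
    (hXb.integrable_trace _) (t ^ (2 * p))
  have hsub : {ω : κ → α | t < ‖∑ i, Z i (ω i) - ∑ i, ∫ a, Z i a ∂μ‖} ⊆
      {ω | t ^ (2 * p) ≤ (trace ((∑ i, Y i (ω i)) ^ (2 * p))).re} := by
    intro ω hω
    by_contra hlt
    rw [Set.mem_ofPred_eq, not_le] at hlt
    have := norm_le_of_trace_pow_le (isSelfAdjoint_sum _ fun i _ => hYH i (ω i)) hp ht.le hlt.le
    rw [hY, Finset.sum_sub_distrib] at this
    exact absurd hω (not_lt.2 this)
  refine (measure_mono hsub).trans ?_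
  have hpos : 0 < t ^ (2 * p) := by positivity
  rw [← ofReal_measureReal]
  refine ENNReal.ofReal_le_ofReal ?_
  rw [div_pow, ← pow_mul, mul_div_assoc', le_div_iff₀ hpos, mul_comm]
  exact hmarkov.trans hm

end Sum

end MatrixMoment

end

/-! ### Quadratic forms and operator norms. -/

noncomputable section

open Matrix
open scoped Matrix.Norms.L2Operator

section QuadraticForm

variable {ι : Type*} [Fintype ι]

/-- The squared Euclidean norm of a state. -/
def normSqSum (ψ : ι → ℂ) : ℝ := ∑ x, ‖ψ x‖ ^ 2

/-- The real quadratic form of a matrix. -/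
def quadForm (A : Matrix ι ι ℂ) (ψ : ι → ℂ) : ℝ := (star ψ ⬝ᵥ A.mulVec ψ).re

theorem normSqSum_eq (ψ : ι → ℂ) : normSqSum ψ = ‖WithLp.toLp 2 ψ‖ ^ 2 := by
  rw [EuclideanSpace.norm_sq_eq]; rfl

theorem normSqSum_nonneg (ψ : ι → ℂ) : 0 ≤ normSqSum ψ :=
  Finset.sum_nonneg fun _ _ => sq_nonneg _

theorem quadForm_add (A B : Matrix ι ι ℂ) (ψ : ι → ℂ) :
    quadForm (A + B) ψ = quadForm A ψ + quadForm B ψ := by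
  simp [quadForm, add_mulVec, dotProduct_add]

theorem quadForm_sub (A B : Matrix ι ι ℂ) (ψ : ι → ℂ) :
    quadForm (A - B) ψ = quadForm A ψ - quadForm B ψ := by
  simp [quadForm, sub_mulVec, dotProduct_sub]

theorem quadForm_sum {κ : Type*} (s : Finset κ) (A : κ → Matrix ι ι ℂ) (ψ : ι → ℂ) :
    quadForm (∑ i ∈ s, A i) ψ = ∑ i ∈ s, quadForm (A i) ψ := by
  simp [quadForm, sum_mulVec, dotProduct_sum]

theorem quadForm_smul (c : ℝ) (A : Matrix ι ι ℂ) (ψ : ι → ℂ) :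
    quadForm (c • A) ψ = c * quadForm A ψ := by
  simp [quadForm, smul_mulVec, dotProduct_smul]

/-- A matrix with positive quadratic form is bounded below. -/
theorem exists_pos_mul_normSqSum_le {A : Matrix ι ι ℂ} (h : ∀ ψ ≠ 0, 0 < quadForm A ψ) :
    ∃ c : ℝ, 0 < c ∧ ∀ ψ, c * normSqSum ψ ≤ quadForm A ψ := by
  rcases isEmpty_or_nonempty ι with hι | hι
  · exact ⟨1, one_pos, fun ψ => by simp [normSqSum, quadForm]⟩
  have hcont : Continuous fun x : EuclideanSpace ℂ ι => quadForm A (WithLp.ofLp x) := by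
    unfold quadForm
    simp only [dotProduct, mulVec]
    fun_prop
  -- The constant is the minimum of the form over the unit sphere; homogeneity of degree two extends
  -- the bound to all vectors.
  obtain ⟨x₀, hx₀, hmin⟩ := (isCompact_sphere (0 : EuclideanSpace ℂ ι) 1).exists_isMinOn
    (NormedSpace.sphere_nonempty.2 zero_le_one) hcont.continuousOn
  have hx₀' : ‖x₀‖ = 1 := by simpa using hx₀
  refine ⟨quadForm A (WithLp.ofLp x₀), h _ fun h0 => ?_, fun ψ => ?_⟩
  · have : x₀ = 0 := by ext i; exact congrFun h0 i
    simp [this] at hx₀'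
  by_cases hψ : ψ = 0
  · simp [hψ, normSqSum, quadForm]
  have hn : 0 < ‖WithLp.toLp 2 ψ‖ := by
    rw [norm_pos_iff]; simpa using hψ
  have hq : ∀ c : ℝ, quadForm A ((c : ℂ) • ψ) = c ^ 2 * quadForm A ψ := by
    intro c
    simp only [quadForm, mulVec_smul, star_smul, smul_dotProduct, dotProduct_smul, smul_eq_mul]
    rw [← mul_assoc]
    have : (c : ℂ) * star (c : ℂ) = ((c ^ 2 : ℝ) : ℂ) := by simp [sq]
    rw [this, Complex.re_ofReal_mul]
  have hmem : ((‖WithLp.toLp 2 ψ‖⁻¹ : ℝ) : ℂ) • WithLp.toLp 2 ψ ∈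
      Metric.sphere (0 : EuclideanSpace ℂ ι) 1 := by
    rw [mem_sphere_zero_iff_norm, norm_smul, Complex.norm_real, norm_inv, norm_norm,
      inv_mul_cancel₀ hn.ne']
  have h1 := hmin hmem
  have h2 := hq (‖WithLp.toLp 2 ψ‖⁻¹)
  have h3 : quadForm A (WithLp.ofLp x₀) ≤ (‖WithLp.toLp 2 ψ‖⁻¹) ^ 2 * quadForm A ψ := by
    rw [← h2]; exact h1
  rw [normSqSum_eq]
  have h4 := mul_le_mul_of_nonneg_right h3 (sq_nonneg ‖WithLp.toLp 2 ψ‖)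
  refine h4.trans (le_of_eq ?_)
  field_simp

variable [DecidableEq ι]

theorem normSqSum_mulVec_le (A : Matrix ι ι ℂ) (ψ : ι → ℂ) :
    normSqSum (A *ᵥ ψ) ≤ ‖A‖ ^ 2 * normSqSum ψ := by
  rw [normSqSum_eq, normSqSum_eq, ← mul_pow]
  exact pow_le_pow_left₀ (norm_nonneg _) (l2_opNorm_mulVec A (WithLp.toLp 2 ψ)) 2

theorem norm_le_of_normSqSum_mulVec_le {A : Matrix ι ι ℂ} {C : ℝ} (hC : 0 ≤ C)
    (h : ∀ ψ, normSqSum (A *ᵥ ψ) ≤ C ^ 2 * normSqSum ψ) : ‖A‖ ≤ C := by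
  rw [l2_opNorm_def]
  refine ContinuousLinearMap.opNorm_le_bound _ hC fun x => ?_
  have := h (WithLp.ofLp x)
  rw [normSqSum_eq, normSqSum_eq, ← mul_pow] at this
  exact le_of_sq_le_sq this (by positivity)

theorem abs_quadForm_le (A : Matrix ι ι ℂ) (ψ : ι → ℂ) :
    |quadForm A ψ| ≤ ‖A‖ * normSqSum ψ := by
  have h : star ψ ⬝ᵥ A *ᵥ ψ = inner ℂ (WithLp.toLp 2 ψ) (WithLp.toLp 2 (A *ᵥ ψ)) := by
    rw [EuclideanSpace.inner_eq_star_dotProduct, dotProduct_comm]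
  unfold quadForm
  rw [h, normSqSum_eq]
  refine (Complex.abs_re_le_norm _).trans ((norm_inner_le_norm _ _).trans ?_)
  have := mul_le_mul_of_nonneg_left (l2_opNorm_mulVec A (WithLp.toLp 2 ψ))
    (norm_nonneg (WithLp.toLp 2 ψ))
  refine this.trans (le_of_eq ?_)
  ring

end QuadraticForm

/-! ### Lifting a matrix on `r` qubits to `n` qubits. -/

section Lift

variable {n r : ℕ} (T : Fin r ↪ Fin n)

/-- Splitting a bit string into its restriction to the range of `T` and the rest. -/
def bitSplit : (Fin n → Fin 2) ≃ (Fin r → Fin 2) × ({q // q ∉ Set.range T} → Fin 2) where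
  toFun x := (x ∘ T, fun q => x q)
  invFun p := open Classical in
    fun q => if h : q ∈ Set.range T then p.1 h.choose else p.2 ⟨q, h⟩
  left_inv x := by
    funext q
    by_cases h : q ∈ Set.range T
    · simp only [h, dif_pos, Function.comp_apply]
      rw [h.choose_spec]
    · simp [h]
  right_inv p := by
    refine Prod.ext ?_ ?_
    · funext j
      have h : T j ∈ Set.range T := ⟨j, rfl⟩
      simp only [Function.comp_apply, h, dif_pos]
      rw [T.injective h.choose_spec]
    · funext q
      simp [q.2]

theorem liftTerm_bitSplit_symm (M : QMat r) (y y' : Fin r → Fin 2)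
    (z z' : {q // q ∉ Set.range T} → Fin 2) :
    liftTerm T M ((bitSplit T).symm (y, z)) ((bitSplit T).symm (y', z')) =
      if z = z' then M y y' else 0 := by
  set x := (bitSplit T).symm (y, z) with hx
  set x' := (bitSplit T).symm (y', z') with hx'
  have e : bitSplit T x = (y, z) := by simp [hx]
  have e' : bitSplit T x' = (y', z') := by simp [hx']
  have e1 : x ∘ T = y := congrArg Prod.fst e
  have e2 : (fun q : {q // q ∉ Set.range T} => x q) = z := congrArg Prod.snd e
  have e1' : x' ∘ T = y' := congrArg Prod.fst e'
  have e2' : (fun q : {q // q ∉ Set.range T} => x' q) = z' := congrArg Prod.snd e'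
  unfold liftTerm
  rw [e1, e1', ← e2, ← e2']
  congr 1
  simp [funext_iff]

/-- In the coordinates `(y, z)` the lift is block diagonal, with one copy of `M` for each `z`. Norm
bounds and lower bounds for `M` therefore pass to the lift with no dependence on `n`. -/
theorem liftTerm_mulVec_bitSplit_symm (M : QMat r) (ψ : (Fin n → Fin 2) → ℂ)
    (y : Fin r → Fin 2) (z : {q // q ∉ Set.range T} → Fin 2) :
    (liftTerm T M *ᵥ ψ) ((bitSplit T).symm (y, z)) =
      (M *ᵥ fun y' => ψ ((bitSplit T).symm (y', z))) y := by
  simp only [mulVec, dotProduct]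
  rw [← (bitSplit T).symm.sum_comp, Fintype.sum_prod_type]
  refine Finset.sum_congr rfl fun y' _ => ?_
  simp [liftTerm_bitSplit_symm]

theorem normSqSum_bitSplit (ψ : (Fin n → Fin 2) → ℂ) :
    normSqSum ψ = ∑ z, normSqSum fun y => ψ ((bitSplit T).symm (y, z)) := by
  unfold normSqSum
  rw [← (bitSplit T).symm.sum_comp, Fintype.sum_prod_type_right]

theorem quadForm_liftTerm (M : QMat r) (ψ : (Fin n → Fin 2) → ℂ) :
    quadForm (liftTerm T M) ψ = ∑ z, quadForm M fun y => ψ ((bitSplit T).symm (y, z)) := by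
  unfold quadForm
  simp only [dotProduct, ← Complex.re_sum]
  rw [← (bitSplit T).symm.sum_comp, Fintype.sum_prod_type_right]
  simp_rw [liftTerm_mulVec_bitSplit_symm]
  rfl

theorem norm_liftTerm_le (M : QMat r) : ‖liftTerm T M‖ ≤ ‖M‖ := by
  refine norm_le_of_normSqSum_mulVec_le (norm_nonneg _) fun ψ => ?_
  rw [normSqSum_bitSplit T, normSqSum_bitSplit T ψ, Finset.mul_sum]
  refine Finset.sum_le_sum fun z _ => ?_
  simp_rw [liftTerm_mulVec_bitSplit_symm]
  exact normSqSum_mulVec_le M _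

theorem le_quadForm_liftTerm {M : QMat r} {c : ℝ}
    (h : ∀ φ, c * normSqSum φ ≤ quadForm M φ) (ψ : (Fin n → Fin 2) → ℂ) :
    c * normSqSum ψ ≤ quadForm (liftTerm T M) ψ := by
  rw [normSqSum_bitSplit T, quadForm_liftTerm, Finset.mul_sum]
  exact Finset.sum_le_sum fun z _ => h _

/-- `M ↦ M|_T ⊗ Id` as a continuous linear map. -/
def liftTermCLM : QMat r →L[ℝ] QMat n :=
  LinearMap.toContinuousLinearMap
    { toFun := liftTerm T
      map_add' := fun A B => by
        ext x y
        simp only [liftTerm, Matrix.add_apply]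
        split_ifs <;> simp
      map_smul' := fun c A => by
        ext x y
        simp only [liftTerm, Matrix.smul_apply, RingHom.id_apply]
        split_ifs <;> simp }

theorem isHermitian_liftTerm {M : QMat r} (hM : M.IsHermitian) : (liftTerm T M).IsHermitian := by
  ext x y
  have h : (∀ q, q ∉ Set.range T → x q = y q) ↔ (∀ q, q ∉ Set.range T → y q = x q) := by
    simp only [eq_comm]
  simp only [conjTranspose_apply, liftTerm]
  by_cases hxy : ∀ q, q ∉ Set.range T → x q = y q
  · rw [if_pos hxy, if_pos (h.1 hxy), hM.apply]
  · rw [if_neg hxy, if_neg (fun h' => hxy (h.2 h')), star_zero]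

end Lift

end

/-! ### Admissible laws: boundedness and positive definiteness of the mean. -/

noncomputable section

open Matrix
open scoped Matrix.Norms.L2Operator

section Law

variable {r : ℕ}

instance QMat.borelSpace : BorelSpace (QMat r) :=
  inferInstanceAs (BorelSpace ((Fin r → Fin 2) → (Fin r → Fin 2) → ℂ))

/-- The bounded positive semidefinite matrices. -/
def boundedPSD (r : ℕ) (B : ℝ) : Set (QMat r) := {M | M.PosSemidef ∧ ‖M‖ ≤ B}

theorem isClosed_boundedPSD (B : ℝ) : IsClosed (boundedPSD r B) := by
  have : boundedPSD r B = {M : QMat r | Mᴴ = M} ∩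
      (⋂ x : (Fin r → Fin 2) → ℂ, {M : QMat r | 0 ≤ star x ⬝ᵥ (M *ᵥ x)}) ∩
      {M : QMat r | ‖M‖ ≤ B} := by
    ext M
    simp only [boundedPSD, Set.mem_ofPred_eq, Set.mem_inter_iff, Set.mem_iInter,
      posSemidef_iff_dotProduct_mulVec]
    rfl
  rw [this]
  refine IsClosed.inter (IsClosed.inter ?_ (isClosed_iInter fun x => ?_)) ?_
  · exact isClosed_eq (Continuous.matrix_conjTranspose continuous_id) continuous_id
  · refine isClosed_le continuous_const ?_
    exact Continuous.dotProduct continuous_const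
      (Continuous.matrix_mulVec continuous_id continuous_const)
  · exact isClosed_le continuous_norm continuous_const

theorem measurableSet_boundedPSD (B : ℝ) : MeasurableSet (boundedPSD r B) :=
  (isClosed_boundedPSD B).measurableSet

/-- Truncation to the bounded positive semidefinite matrices. -/
def truncPSD (r : ℕ) (B : ℝ) : QMat r → QMat r := (boundedPSD r B).indicator id

theorem truncPSD_of_mem {B : ℝ} {M : QMat r} (hM : M ∈ boundedPSD r B) : truncPSD r B M = M :=
  Set.indicator_of_mem hM _

theorem truncPSD_mem {B : ℝ} (hB : 0 ≤ B) (M : QMat r) : truncPSD r B M ∈ boundedPSD r B := by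
  by_cases hM : M ∈ boundedPSD r B
  · rwa [truncPSD_of_mem hM]
  · rw [truncPSD, Set.indicator_of_notMem hM]
    exact ⟨PosSemidef.zero, by simpa using hB⟩

/-- The law is bounded and positive semidefinite only almost surely, whereas the tail bound asks for
this everywhere; truncation bridges the gap at the cost of a null set. -/
theorem bddMeas_truncPSD {B : ℝ} (hB : 0 ≤ B) : MatrixMoment.BddMeas (truncPSD r B) :=
  ⟨(measurable_id.indicator (measurableSet_boundedPSD B)).stronglyMeasurable, B,
    fun M => (truncPSD_mem hB M).2⟩

/-- Vectors orthogonal to a fixed nonzero vector in one coordinate form a null set. -/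
theorem volume_dotProduct_eq_zero {R : ℕ} (i : Fin R) {φ : (Fin r → Fin 2) → ℂ} (hφ : φ ≠ 0) :
    volume {v : Fin R → (Fin r → Fin 2) → ℂ | star φ ⬝ᵥ v i = 0} = 0 := by
  let S : Submodule ℝ (Fin R → (Fin r → Fin 2) → ℂ) :=
    { carrier := {v | star φ ⬝ᵥ v i = 0}
      add_mem' := fun {a b} ha hb => by
        simp only [Set.mem_ofPred_eq] at ha hb ⊢
        rw [Pi.add_apply, dotProduct_add, ha, hb, add_zero]
      zero_mem' := by simp
      smul_mem' := fun c a ha => by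
        simp only [Set.mem_ofPred_eq] at ha ⊢
        rw [Pi.smul_apply, dotProduct_smul, ha, smul_zero] }
  -- The real subspace is proper because it misses the tuple constantly equal to `φ`; proper
  -- subspaces are Haar null.
  have hS : S ≠ ⊤ := by
    intro h
    have hmem : (fun _ => φ) ∈ S := h ▸ Submodule.mem_top
    have hz : star φ ⬝ᵥ φ = 0 := hmem
    exact hφ (dotProduct_star_self_eq_zero.1 hz)
  have : (volume : Measure (Fin R → (Fin r → Fin 2) → ℂ)).IsAddHaarMeasure :=
    Measure.pi.isAddHaarMeasure _
  exact Measure.addHaar_submodule volume S hS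

/-- A predicate law is concentrated on bounded positive semidefinite matrices, and its mean is
positive definite. -/
theorem IsPredicateLaw.exists_bounds {R : ℕ} (hR : 0 < R) {D : Measure (QMat r)}
    [IsProbabilityMeasure D] (hD : IsPredicateLaw r R D) :
    ∃ B c : ℝ, 0 < B ∧ 0 < c ∧ (∀ᵐ M ∂D, M ∈ boundedPSD r B) ∧
      ∀ φ, c * normSqSum φ ≤ quadForm (∫ M, truncPSD r B M ∂D) φ := by
  obtain ⟨B₀, ν, hfst, hsnd, hae⟩ := hD
  set B := max B₀ 1 with hBdef
  have hB : 0 < B := lt_max_of_lt_right one_pos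
  have hmem : ∀ᵐ M ∂D, M ∈ boundedPSD r B := by
    rw [← hfst]
    refine (ae_map_iff measurable_fst.aemeasurable (measurableSet_boundedPSD B)).2 ?_
    filter_upwards [hae] with p hp
    exact ⟨hp.1, hp.2.2.2.trans (le_max_left _ _)⟩
  have hint : Integrable (truncPSD r B) D := (bddMeas_truncPSD hB.le).integrable D
  have hpos : ∀ φ ≠ 0, 0 < quadForm (∫ M, truncPSD r B M ∂D) φ := by
    intro φ hφ
    let Q : QMat r →L[ℝ] ℝ := LinearMap.toContinuousLinearMap
      { toFun := fun A => quadForm A φ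
        map_add' := fun A A' => quadForm_add A A' φ
        map_smul' := fun c A => quadForm_smul c A φ }
    have e : quadForm (∫ M, truncPSD r B M ∂D) φ = ∫ M, quadForm (truncPSD r B M) φ ∂D :=
      (Q.integral_comp_comm hint).symm
    have hnn : ∀ M, 0 ≤ quadForm (truncPSD r B M) φ := fun M =>
      (Complex.le_def.1 ((truncPSD_mem hB.le M).1.dotProduct_mulVec_nonneg φ)).1
    rw [e]
    refine lt_of_le_of_ne (integral_nonneg hnn) fun h0 => ?_
    have h1 := (integral_eq_zero_iff_of_nonneg hnn (Q.integrable_comp hint)).1 h0.symm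
    have h2 : ∀ᵐ M ∂D, M *ᵥ φ = 0 := by
      filter_upwards [h1, hmem] with M hM hM'
      rw [truncPSD_of_mem hM', Pi.zero_apply] at hM
      rw [← hM'.1.dotProduct_mulVec_zero_iff φ]
      refine Complex.ext hM ?_
      exact (Complex.le_def.1 (hM'.1.dotProduct_mulVec_nonneg φ)).2.symm
    have h3 : ∀ᵐ p ∂ν, p.1 *ᵥ φ = 0 := by
      rw [← hfst] at h2
      exact ae_of_ae_map measurable_fst.aemeasurable h2
    -- The range of a Hermitian matrix is orthogonal to its kernel, and the range contains every
    -- `vᵢ`.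
    have h4 : ∀ᵐ p ∂ν, p.2 ∈ {v : Fin R → (Fin r → Fin 2) → ℂ | star φ ⬝ᵥ v ⟨0, hR⟩ = 0} := by
      filter_upwards [h3, hae] with p hp hp'
      have hv : p.2 ⟨0, hR⟩ ∈ LinearMap.range p.1.mulVecLin := by
        rw [hp'.2.2.1]
        exact Submodule.subset_span ⟨_, rfl⟩
      obtain ⟨u, hu⟩ := hv
      change star φ ⬝ᵥ p.2 ⟨0, hR⟩ = 0
      rw [← hu, mulVecLin_apply, dotProduct_mulVec, ← hp'.1.1.eq,
        ← star_mulVec, hp, star_zero, zero_dotProduct]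
    have hcl : IsClosed {v : Fin R → (Fin r → Fin 2) → ℂ | star φ ⬝ᵥ v ⟨0, hR⟩ = 0} :=
      isClosed_eq (Continuous.dotProduct continuous_const (continuous_apply _)) continuous_const
    have h5 := hsnd (volume_dotProduct_eq_zero ⟨0, hR⟩ hφ)
    rw [Measure.map_apply measurable_snd hcl.measurableSet] at h5
    -- An event and its complement are both null, so `ν` and its marginal `D` vanish, which is
    -- absurd for a probability measure.
    have h6 : ν Set.univ = 0 := by
      refine measure_mono_null (t := _ ∪ _) (fun p _ => ?_) (measure_union_null h5 h4)
      by_cases hp : p.2 ∈ {v : Fin R → (Fin r → Fin 2) → ℂ | star φ ⬝ᵥ v ⟨0, hR⟩ = 0}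
      · exact Or.inl hp
      · exact Or.inr hp
    have h7 : D Set.univ = 0 := by
      rw [← hfst, Measure.map_apply measurable_fst MeasurableSet.univ, Set.preimage_univ, h6]
    simp at h7
  obtain ⟨c, hc, h⟩ := exists_pos_mul_normSqSum_le hpos
  exact ⟨B, c, hB, hc, hmem, h⟩

end Law

end

/-! ### The sampling program, its output and its running time. -/

noncomputable section

section Program

/-- The number with binary digits `f 0, …, f (l - 1)`, most significant first. -/
def bitOffset (f : ℕ → Bool) : ℕ → ℕ
  | 0 => 0
  | l + 1 => bitOffset f l + bitOffset f l + if f l then 1 else 0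

theorem bitOffset_lt (f : ℕ → Bool) (l : ℕ) : bitOffset f l < 2 ^ l := by
  induction l with
  | zero => simp [bitOffset]
  | succ l ih =>
    rw [bitOffset, pow_succ]
    split_ifs <;> omega

theorem bitOffset_congr {f g : ℕ → Bool} {L : ℕ} (h : ∀ l < L, f l = g l) :
    bitOffset f L = bitOffset g L := by
  induction L with
  | zero => rfl
  | succ L ih =>
    rw [bitOffset, bitOffset, ih fun l hl => h l (by omega), h L (by omega)]

/-- The weights produced by picking one term from each block of `2 ^ L` consecutive terms; the
choice in the `b`-th block is read off the random bits `b L, …, b L + L - 1`. -/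
def blockWeight (L : ℕ) (ω : ℕ → Bool) (i : ℕ) : ℝ :=
  if i % 2 ^ L = bitOffset (fun l => ω (i / 2 ^ L * L + l)) L then 2 ^ L else 0

/-- Straight-line programs. -/
def RProg.ofList : RInstr → List RInstr → RProg
  | c, [] => .instr c
  | c, c' :: l => .seq (.instr c) (RProg.ofList c' l)

theorem RProg.runs_ofList (x : RInput) (ω : ℕ → Bool) (c : RInstr) (l : List RInstr)
    (s : RState) : RProg.Runs x ω (RProg.ofList c l) s
      (l.foldl (fun s c => c.exec x ω s) (c.exec x ω s)) (l.length + 1) := by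
  induction l generalizing c s with
  | nil => exact .instr c s
  | cons c' l ih =>
    rw [List.length_cons, add_comm (l.length + 1) 1]
    exact .seq (.instr c s) (ih c' (c.exec x ω s))

/-- Doubles the block length `I[4]` and `X[3]` as long as `X[3] < X[2]`. -/
def levelLoop : RProg :=
  .loop (.rlt 3 2) (.ofList (.iadd 4 4 4) [.radd 3 3 3])

/-- Reads the random bits of one block into the offset `I[6]`. -/
def offsetLoop : RProg :=
  -- `I[7]` doubles from `1` up to the block length `I[4] = 2 ^ L`, so exactly `L` bits are read
  -- although `L` itself is not stored.
  .loop (.ilt 7 4) (.ofList (.flip 8) [.iadd 6 6 6, .iadd 6 6 8, .iadd 7 7 7])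

/-- Picks a random term in each block. -/
def blockLoop : RProg :=
  .loop (.ilt 5 3) (.seq (.ofList (.iconst 6 0) [.iconst 7 1]) (.seq offsetLoop
    (.ofList (.iadd 6 6 5) [.write 6 5, .iadd 5 5 4])))

/-- The sampling algorithm: for `ε < 1`, choose the block length as the least power of two that is
at least `m ε ² / (C n)`, and sample one term from each block. -/
def samplingProgram (C : ℕ) : RProg :=
  .seq (.ofList (.iconst 1 1) [.iread 2 0, .iread 3 1, .rread 0 0, .rconst 1 1])
    (.branch (.rlt 0 1)
      -- Sets `X[2] = m ε²`, `X[3] = C n` and block length `1`.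
      (.seq (.ofList (.cast 2 3)
        [.rmul 2 2 0, .rmul 2 2 0, .cast 3 2, .rconst 4 C, .rmul 3 3 4, .iconst 4 1])
        (.seq levelLoop (.seq (.instr (.cast 5 4)) blockLoop)))
      -- A dummy instruction: for `ε ≥ 1` the untouched output is the zero weight function.
      (.instr (.iconst 0 0)))

variable (x : RInput) (ω : ℕ → Bool)

theorem runs_levelLoop {u v : ℝ} {L : ℕ} (hlt : ∀ j < L, u * 2 ^ j < v) (hL : ¬ u * 2 ^ L < v)
    (k : ℕ) : ∀ (j : ℕ) (s : RState), k + j = L → s.imem 4 = 2 ^ j → s.rmem 2 = v →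
      s.rmem 3 = u * 2 ^ j → ∃ s', RProg.Runs x ω levelLoop s s' (3 * k + 1) ∧
        s'.imem 4 = 2 ^ L ∧ (∀ a, a ≠ 4 → s'.imem a = s.imem a) ∧ s'.out = s.out ∧
        s'.pos = s.pos := by
  induction k with
  | zero =>
    intro j s hj h4 h2 h3
    obtain rfl : j = L := by omega
    refine ⟨s, .loop_false ?_, h4, fun _ _ => rfl, rfl, rfl⟩
    simpa only [RTest.Holds, h2, h3] using hL
  | succ k ih =>
    intro j s hj h4 h2 h3
    have hb : (RTest.rlt 3 2).Holds s := by
      simpa only [RTest.Holds, h2, h3] using hlt j (by omega)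
    have hrun := RProg.runs_ofList x ω (.iadd 4 4 4) [.radd 3 3 3] s
    obtain ⟨s₁, hs₁⟩ : ∃ s₁, s₁ = List.foldl (fun s c => RInstr.exec x ω c s)
      (RInstr.exec x ω (.iadd 4 4 4) s) [.radd 3 3 3] := ⟨_, rfl⟩
    rw [← hs₁] at hrun
    obtain ⟨s', hr, h4', himem, hout, hpos⟩ := ih (j + 1) s₁ (by omega)
      (by simp [hs₁, RInstr.exec, h4, pow_succ]; ring)
      (by simp [hs₁, RInstr.exec, h2])
      (by simp [hs₁, RInstr.exec, h3, pow_succ]; ring)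
    refine ⟨s', ?_, h4', fun a ha => ?_, by rw [hout, hs₁]; rfl, by rw [hpos, hs₁]; rfl⟩
    · have := RProg.Runs.loop_true hb hrun hr
      have e : ([RInstr.radd 3 3 3].length + 1) + (3 * k + 1) + 1 = 3 * (k + 1) + 1 := by
        simp; ring
      rwa [e] at this
    · rw [himem a ha]
      simp [hs₁, RInstr.exec, ha]

theorem runs_offsetLoop {q L : ℕ} (k : ℕ) : ∀ (j : ℕ) (s : RState), k + j = L →
    s.imem 7 = 2 ^ j → s.imem 4 = 2 ^ L → s.imem 6 = bitOffset (fun l => ω (q + l)) j →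
    s.pos = q + j → ∃ s', RProg.Runs x ω offsetLoop s s' (5 * k + 1) ∧
      s'.imem 6 = bitOffset (fun l => ω (q + l)) L ∧ (∀ a < 6, s'.imem a = s.imem a) ∧
      s'.rmem = s.rmem ∧ s'.out = s.out ∧ s'.pos = q + L := by
  induction k with
  | zero =>
    intro j s hj h7 h4 h6 hpos
    obtain rfl : j = L := by omega
    refine ⟨s, .loop_false ?_, h6, fun _ _ => rfl, rfl, rfl, hpos⟩
    simp only [RTest.Holds, h7, h4, lt_irrefl, not_false_iff]
  | succ k ih =>
    intro j s hj h7 h4 h6 hpos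
    have hb : (RTest.ilt 7 4).Holds s := by
      simp only [RTest.Holds, h7, h4]
      exact Nat.pow_lt_pow_right (by norm_num) (by omega)
    have hrun := RProg.runs_ofList x ω (.flip 8) [.iadd 6 6 6, .iadd 6 6 8, .iadd 7 7 7] s
    obtain ⟨s₁, hs₁⟩ : ∃ s₁, s₁ = List.foldl (fun s c => RInstr.exec x ω c s)
      (RInstr.exec x ω (.flip 8) s) [.iadd 6 6 6, .iadd 6 6 8, .iadd 7 7 7] := ⟨_, rfl⟩
    rw [← hs₁] at hrun
    obtain ⟨s', hr, h6', himem, hrmem, hout, hpos'⟩ := ih (j + 1) s₁ (by omega)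
      (by simp [hs₁, RInstr.exec, h7, pow_succ]; ring)
      (by simp [hs₁, RInstr.exec, h4])
      (by simp [hs₁, RInstr.exec, h6, bitOffset, hpos])
      (by simp [hs₁, RInstr.exec, hpos]; ring)
    refine ⟨s', ?_, h6', fun a ha => ?_, by rw [hrmem, hs₁]; rfl, by rw [hout, hs₁]; rfl, hpos'⟩
    · have := RProg.Runs.loop_true hb hrun hr
      have e : ([RInstr.iadd 6 6 6, .iadd 6 6 8, .iadd 7 7 7].length + 1) + (5 * k + 1) + 1 =
        5 * (k + 1) + 1 := by simp; ring
      rwa [e] at this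
    · rw [himem a ha]
      have h1 : a ≠ 6 := by omega
      have h2 : a ≠ 7 := by omega
      have h3 : a ≠ 8 := by omega
      simp [hs₁, RInstr.exec, h1, h2, h3]

/-- Here `k` bounds the number of cells still to be covered, and each block covers at least one. The
invariant: cells before the current block are final, later ones are `0`. -/
theorem runs_blockLoop {m L : ℕ} (k : ℕ) : ∀ (b : ℕ) (s : RState), m - b * 2 ^ L ≤ k →
    s.imem 3 = m → s.imem 4 = 2 ^ L → s.imem 5 = b * 2 ^ L → s.rmem 5 = 2 ^ L →
    s.pos = b * L → (∀ i < b * 2 ^ L, s.out i = blockWeight L ω i) →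
    (∀ i, b * 2 ^ L ≤ i → s.out i = 0) →
    ∃ s' t, RProg.Runs x ω blockLoop s s' t ∧ t ≤ k * (5 * L + 7) + 1 ∧
      ∀ i < m, s'.out i = blockWeight L ω i := by
  have hS : 0 < 2 ^ L := by positivity
  induction k with
  | zero =>
    intro b s hk h3 h4 h5 hr5 hpos hout hout0
    refine ⟨s, _, .loop_false ?_, by simp, fun i hi => hout i (by omega)⟩
    simp only [RTest.Holds, h5, h3]
    omega
  | succ k ih =>
    intro b s hk h3 h4 h5 hr5 hpos hout hout0
    by_cases hlt : b * 2 ^ L < m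
    swap
    · refine ⟨s, _, .loop_false ?_, by simp, fun i hi => hout i (by omega)⟩
      simpa only [RTest.Holds, h5, h3] using hlt
    have hb : (RTest.ilt 5 3).Holds s := by simpa only [RTest.Holds, h5, h3] using hlt
    have hrun := RProg.runs_ofList x ω (.iconst 6 0) [.iconst 7 1] s
    obtain ⟨s₀, hs₀⟩ : ∃ s₀, s₀ = List.foldl (fun s c => RInstr.exec x ω c s)
      (RInstr.exec x ω (.iconst 6 0) s) [.iconst 7 1] := ⟨_, rfl⟩
    rw [← hs₀] at hrun
    obtain ⟨s₁, hr₁, h6₁, himem₁, hrmem₁, hout₁, hpos₁⟩ :=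
      runs_offsetLoop x ω (q := b * L) (L := L) L 0 s₀ (by omega)
        (by simp [hs₀, RInstr.exec]) (by simp [hs₀, RInstr.exec, h4])
        (by simp [hs₀, RInstr.exec, bitOffset]) (by simp [hs₀, RInstr.exec, hpos])
    set o := bitOffset (fun l => ω (b * L + l)) L with ho
    have holt : o < 2 ^ L := bitOffset_lt _ _
    have hrun₂ := RProg.runs_ofList x ω (.iadd 6 6 5) [.write 6 5, .iadd 5 5 4] s₁
    have e3 : s₁.imem 3 = m := by simp [himem₁ 3 (by norm_num), hs₀, RInstr.exec, h3]
    have e4 : s₁.imem 4 = 2 ^ L := by simp [himem₁ 4 (by norm_num), hs₀, RInstr.exec, h4]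
    have e5 : s₁.imem 5 = b * 2 ^ L := by simp [himem₁ 5 (by norm_num), hs₀, RInstr.exec, h5]
    have er : s₁.rmem 5 = 2 ^ L := by simp [hrmem₁, hs₀, RInstr.exec, hr5]
    have eo : s₁.out = s.out := by simp [hout₁, hs₀, RInstr.exec]
    obtain ⟨s₂, hs₂⟩ : ∃ s₂, s₂ = List.foldl (fun s c => RInstr.exec x ω c s)
      (RInstr.exec x ω (.iadd 6 6 5) s₁) [.write 6 5, .iadd 5 5 4] := ⟨_, rfl⟩
    rw [← hs₂] at hrun₂
    -- In an incomplete last block the cell written may lie at or beyond `m`; it is then no weight,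
    -- and the block contributes no term.
    have eo₂ : s₂.out = Function.update s.out (o + b * 2 ^ L) (2 ^ L) := by
      simp [hs₂, RInstr.exec, eo, er, h6₁, e5]
    obtain ⟨s₃, t, hr₂, ht, hfin⟩ := ih (b + 1) s₂ (by rw [add_mul]; omega)
      (by simp [hs₂, RInstr.exec, e3]) (by simp [hs₂, RInstr.exec, e4])
      (by simp [hs₂, RInstr.exec, e4, e5]; ring) (by simp [hs₂, RInstr.exec, er])
      (by simp [hs₂, RInstr.exec, hpos₁]; ring)
      (by
        intro i hi
        rw [eo₂, Function.update_apply]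
        by_cases hib : i < b * 2 ^ L
        · rw [if_neg (by omega), hout i hib]
        · have hdiv : i / 2 ^ L = b := by
            rw [Nat.div_eq_iff hS]; rw [add_mul] at hi; omega
          have hmod : i % 2 ^ L = i - b * 2 ^ L := by
            have := Nat.div_add_mod' i (2 ^ L)
            rw [hdiv] at this; omega
          rw [blockWeight, hdiv, hmod, ← ho, hout0 i (by omega)]
          by_cases hio : i = o + b * 2 ^ L
          · rw [if_pos hio, if_pos (by omega)]
          · rw [if_neg hio, if_neg (by omega)])
      (by
        intro i hi
        rw [eo₂, Function.update_apply]
        rw [add_mul] at hi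
        rw [if_neg (by omega), hout0 i (by omega)])
    refine ⟨s₃, _, .loop_true hb (.seq hrun (.seq hr₁ hrun₂)) hr₂, ?_, hfin⟩
    simp only [List.length_cons, List.length_nil]
    rw [add_mul]
    omega

/-- The choice of block length: it exists and is small. -/
theorem exists_level {n m : ℕ} (hnm : n = 0 → m = 0) {C : ℕ} (hC : 1 ≤ C) {ε : ℝ} (hε : 0 < ε)
    (hε1 : ε < 1) : ∃ L ≤ m, (∀ j < L, (n * C : ℝ) * 2 ^ j < m * ε * ε) ∧
      ¬ (n * C : ℝ) * 2 ^ L < m * ε * ε := by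
  classical
  -- The level `m` already stops the search, since `n C 2 ^ m ≥ 2 ^ m ≥ m ≥ m ε²`; this gives `L ≤
  -- m`.
  have hm : ¬ (n * C : ℝ) * 2 ^ m < m * ε * ε := by
    rcases Nat.eq_zero_or_pos n with rfl | hn
    · simp [hnm rfl]
    rw [not_lt]
    have h1 : (m : ℝ) * ε * ε ≤ m := by
      have : ε * ε ≤ 1 := by nlinarith
      nlinarith [Nat.cast_nonneg (α := ℝ) m]
    have h2 : (m : ℝ) ≤ 2 ^ m := by exact_mod_cast Nat.lt_two_pow_self.le
    have h3 : (1 : ℝ) ≤ n * C := by exact_mod_cast Nat.mul_pos hn hC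
    have h4 : (0 : ℝ) < 2 ^ m := by positivity
    nlinarith
  have hex : ∃ L : ℕ, ¬ (n * C : ℝ) * 2 ^ L < m * ε * ε := ⟨m, hm⟩
  exact ⟨Nat.find hex, Nat.find_min' hex hm, fun j hj => not_not.1 (Nat.find_min hex hj),
    Nat.find_spec hex⟩

theorem runs_samplingProgram {n m r : ℕ} (H : LocalHamiltonian n m r) {ε : ℝ} (hε1 : ε < 1)
    (C : ℕ) {L : ℕ} (hlt : ∀ j < L, (n * C : ℝ) * 2 ^ j < m * ε * ε)
    (hL : ¬ (n * C : ℝ) * 2 ^ L < m * ε * ε) :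
    ∃ s t, RProg.Runs (H.toInput ε) ω (samplingProgram C) RState.start s t ∧
      t ≤ 16 + 3 * L + m * (5 * L + 7) ∧ ∀ i < m, s.out i = blockWeight L ω i := by
  set x := H.toInput ε with hx
  have x0 : x.ints 0 = n := rfl
  have x1 : x.ints 1 = m := rfl
  have y0 : x.reals 0 = ε := rfl
  have h1 := RProg.runs_ofList x ω (.iconst 1 1) [.iread 2 0, .iread 3 1, .rread 0 0,
    .rconst 1 1] RState.start
  set s₁ := List.foldl (fun s c => RInstr.exec x ω c s) (RInstr.exec x ω (.iconst 1 1)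
    RState.start) [.iread 2 0, .iread 3 1, .rread 0 0, .rconst 1 1] with hs₁
  have a2 : s₁.imem 2 = n := by simp [hs₁, RInstr.exec, RState.start, x0]
  have a3 : s₁.imem 3 = m := by simp [hs₁, RInstr.exec, RState.start, x1]
  have a5 : s₁.imem 5 = 0 := by simp [hs₁, RInstr.exec, RState.start]
  have b0 : s₁.rmem 0 = ε := by simp [hs₁, RInstr.exec, RState.start, y0]
  have b1 : s₁.rmem 1 = 1 := by simp [hs₁, RInstr.exec, RState.start]
  have c1 : s₁.out = fun _ => 0 := by simp [hs₁, RInstr.exec, RState.start]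
  have d1 : s₁.pos = 0 := by simp [hs₁, RInstr.exec, RState.start]
  clear_value s₁
  have h2 := RProg.runs_ofList x ω (.cast 2 3) [.rmul 2 2 0, .rmul 2 2 0, .cast 3 2,
    .rconst 4 C, .rmul 3 3 4, .iconst 4 1] s₁
  set s₂ := List.foldl (fun s c => RInstr.exec x ω c s) (RInstr.exec x ω (.cast 2 3) s₁)
    [.rmul 2 2 0, .rmul 2 2 0, .cast 3 2, .rconst 4 C, .rmul 3 3 4, .iconst 4 1] with hs₂
  have e3 : s₂.imem 3 = m := by simp [hs₂, RInstr.exec, a3]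
  have e4 : s₂.imem 4 = 2 ^ 0 := by simp [hs₂, RInstr.exec]
  have e5 : s₂.imem 5 = 0 := by simp [hs₂, RInstr.exec, a5]
  have f2 : s₂.rmem 2 = m * ε * ε := by simp [hs₂, RInstr.exec, a3, b0]
  have f3 : s₂.rmem 3 = (n * C : ℝ) * 2 ^ 0 := by simp [hs₂, RInstr.exec, a2]
  have g2 : s₂.out = fun _ => 0 := by simp [hs₂, RInstr.exec, c1]
  have k2 : s₂.pos = 0 := by simp [hs₂, RInstr.exec, d1]
  clear_value s₂
  obtain ⟨s₃, h3, i4, himem, hout, hpos⟩ :=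
    runs_levelLoop x ω hlt hL L 0 s₂ (by omega) e4 f2 f3
  obtain ⟨s₄, t, h4, ht, hfin⟩ := runs_blockLoop x ω (m := m) (L := L) m 0
    ((RInstr.cast 5 4).exec x ω s₃) (by simp) (by simp [RInstr.exec, himem, e3])
    (by simp [RInstr.exec, i4]) (by simp [RInstr.exec, himem, e5]) (by simp [RInstr.exec, i4])
    (by simp [RInstr.exec, hpos, k2]) (by simp) (by simp [RInstr.exec, hout, g2])
  refine ⟨s₄, _, .seq h1 (.branch_true ?_ (.seq h2 (.seq h3 (.seq (.instr _ _) h4)))), ?_, hfin⟩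
  · simpa only [RTest.Holds, b0, b1] using hε1
  · simp only [List.length_cons, List.length_nil]
    omega

theorem runs_samplingProgram_of_one_le {n m r : ℕ} (H : LocalHamiltonian n m r) {ε : ℝ}
    (hε1 : 1 ≤ ε) (C : ℕ) :
    ∃ s, RProg.Runs (H.toInput ε) ω (samplingProgram C) RState.start s 7 ∧
      ∀ i, s.out i = 0 := by
  have h1 := RProg.runs_ofList (H.toInput ε) ω (.iconst 1 1) [.iread 2 0, .iread 3 1,
    .rread 0 0, .rconst 1 1] RState.start
  refine ⟨_, .seq h1 (.branch_false ?_ (.instr _ _)), fun i => ?_⟩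
  · simp only [RTest.Holds, List.foldl_cons, List.foldl_nil, RInstr.exec]
    simpa [RState.start, LocalHamiltonian.toInput] using hε1
  · simp [RInstr.exec, RState.start]

theorem samplingProgram_halts {n m r : ℕ} (hr : 1 ≤ r) (H : LocalHamiltonian n m r) {ε : ℝ}
    (hε : 0 < ε) {C : ℕ} (hC : 1 ≤ C) : ∃ (s : RState) (t : ℕ),
      (samplingProgram C).Runs (H.toInput ε) ω RState.start s t ∧ t ≤ 16 * (n + m + 1) ^ 16 := by
  rcases le_or_gt 1 ε with hε1 | hε1
  · obtain ⟨s, hs, -⟩ := runs_samplingProgram_of_one_le ω H hε1 C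
    refine ⟨s, 7, hs, le_trans (by norm_num : 7 ≤ 16 * 1) (Nat.mul_le_mul_left 16 ?_)⟩
    exact Nat.one_le_pow _ _ (Nat.succ_pos _)
  · have hnm : n = 0 → m = 0 := by
      rintro rfl
      by_contra hm
      exact (H.qubits ⟨0, Nat.pos_of_ne_zero hm⟩ ⟨0, hr⟩).elim0
    obtain ⟨L, hLm, hlt, hL⟩ := exists_level hnm hC hε hε1
    obtain ⟨s, t, hs, ht, -⟩ := runs_samplingProgram ω H hε1 C hlt hL
    have h2 : 16 + 3 * L + m * (5 * L + 7) ≤ 16 * (n + m + 1) ^ 2 := by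
      have h3 := Nat.mul_le_mul_left m hLm
      ring_nf at h3 ⊢
      nlinarith [Nat.zero_le (n * m), Nat.zero_le (n ^ 2)]
    -- A quadratic bound holds; the exponent grows to `16` because one constant `K` serves as both
    -- factor and exponent.
    exact ⟨s, t, hs, ht.trans (h2.trans
      (Nat.mul_le_mul_left 16 (Nat.pow_le_pow_right (Nat.succ_pos _) (by norm_num))))⟩

end Program

end

/-! ### Random bits and uniform offsets. -/

noncomputable section

open Matrix
open scoped Matrix.Norms.L2Operator

section Coins

/-- The law of one random bit. -/
abbrev bitLaw : Measure Bool := (PMF.uniformOfFintype Bool).toMeasure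

theorem bitLaw_singleton (b : Bool) : bitLaw {b} = 2⁻¹ := by
  rw [PMF.toMeasure_apply_singleton _ _ (MeasurableSet.singleton b)]
  simp

instance : IsProbabilityMeasure coinLaw :=
  inferInstanceAs (IsProbabilityMeasure (Measure.infinitePi fun _ : ℕ => bitLaw))

/-- The first `N` blocks of `L` random bits. -/
def blockBits (N L : ℕ) (ω : ℕ → Bool) (b : Fin N) (l : Fin L) : Bool := ω (b * L + l)

theorem measurable_blockBits (N L : ℕ) : Measurable (blockBits N L) :=
  measurable_pi_lambda _ fun _ => measurable_pi_lambda _ fun _ => measurable_pi_apply _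

/-- Different blocks read disjoint parts of the tape, which is the source of their independence. -/
theorem injective_block_index (N L : ℕ) :
    Function.Injective fun q : Fin N × Fin L => (q.1 * L + q.2 : ℕ) := by
  rintro ⟨b, l⟩ ⟨b', l'⟩ h
  simp only at h
  have hL : 0 < L := by have := l.2; omega
  have h1 : ((b : ℕ) * L + l) / L = b := by
    rw [mul_comm, Nat.mul_add_div hL, Nat.div_eq_of_lt l.2, add_zero]
  have h2 : ((b' : ℕ) * L + l') / L = b' := by
    rw [mul_comm, Nat.mul_add_div hL, Nat.div_eq_of_lt l'.2, add_zero]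
  have h3 : (b : ℕ) = b' := by rw [← h1, ← h2, h]
  have h4 : (l : ℕ) = l' := by rw [h3] at h; omega
  exact Prod.ext (Fin.ext h3) (Fin.ext h4)

/-- Blocks of bits are independent and uniform. -/
theorem map_blockBits (N L : ℕ) : coinLaw.map (blockBits N L) =
    Measure.pi fun _ : Fin N => Measure.pi fun _ : Fin L => bitLaw := by
  refine Measure.ext_of_singleton fun x => ?_
  rw [Measure.map_apply (measurable_blockBits N L) (MeasurableSet.singleton x)]
  set e : Fin N × Fin L → ℕ := fun q => (q.1 * L + q.2 : ℕ) with he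
  have hinj : Function.Injective e := injective_block_index N L
  set y : ℕ → Bool := Function.extend e (fun q => x q.1 q.2) fun _ => false with hy
  have hpre : blockBits N L ⁻¹' {x} =
      Set.pi (Finset.univ.image e : Finset ℕ) fun k => {y k} := by
    ext ω
    simp only [Set.mem_preimage, Set.mem_singleton_iff, Set.mem_pi, Finset.coe_image,
      Finset.coe_univ, Set.image_univ, Set.forall_mem_range]
    constructor
    · rintro rfl q
      rw [hy, hinj.extend_apply]
      rfl
    · intro h
      funext b l
      have := h (b, l)
      rw [hy, hinj.extend_apply] at this
      exact this
  have h := Measure.infinitePi_pi (μ := fun _ : ℕ => bitLaw) (s := Finset.univ.image e)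
    (t := fun k => {y k}) fun _ _ => MeasurableSet.singleton _
  rw [hpre]
  refine h.trans ?_
  simp only [Measure.pi_singleton, bitLaw_singleton, Finset.prod_const,
    Finset.card_image_of_injective _ hinj, Finset.card_univ, Fintype.card_prod, Fintype.card_fin]
  rw [mul_comm N L, pow_mul]

/-- The number encoded by `L` bits. -/
def bitsValue {L : ℕ} (x : Fin L → Bool) : ℕ :=
  bitOffset (fun l => if h : l < L then x ⟨l, h⟩ else false) L

theorem bitOffset_injective {f g : ℕ → Bool} {L : ℕ} (h : bitOffset f L = bitOffset g L) :
    ∀ l < L, f l = g l := by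
  induction L with
  | zero => intro l hl; omega
  | succ L ih =>
    rw [bitOffset, bitOffset] at h
    have h1 : bitOffset f L = bitOffset g L ∧ f L = g L := by
      cases hf : f L <;> cases hg : g L <;> simp [hf, hg] at h ⊢ <;> omega
    intro l hl
    rcases Nat.lt_succ_iff_lt_or_eq.1 hl with h2 | rfl
    · exact ih h1.1 l h2
    · exact h1.2

/-- Binary expansion is injective between two sets of size `2 ^ L`. Fair bits therefore give a
uniform offset. -/
theorem existsUnique_bitsValue_eq {L c : ℕ} (hc : c < 2 ^ L) :
    ∃! x : Fin L → Bool, bitsValue x = c := by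
  have hinj : Function.Injective fun x : Fin L → Bool =>
      (⟨bitsValue x, bitOffset_lt _ _⟩ : Fin (2 ^ L)) := by
    intro x y hxy
    have h := bitOffset_injective (Fin.mk.inj_iff.1 hxy)
    funext l
    simpa using h l l.2
  have hbij := (Fintype.bijective_iff_injective_and_card _).2 ⟨hinj, by simp⟩
  obtain ⟨x, hx, hu⟩ := hbij.existsUnique ⟨c, hc⟩
  exact ⟨x, congrArg Fin.val hx, fun y hy => hu y (Fin.ext hy)⟩

theorem integral_bits {E : Type*} [NormedAddCommGroup E] [NormedSpace ℝ E] [CompleteSpace E]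
    (L : ℕ) (f : (Fin L → Bool) → E) :
    ∫ x, f x ∂(Measure.pi fun _ : Fin L => bitLaw) = ((2 : ℝ) ^ L)⁻¹ • ∑ x, f x := by
  rw [integral_fintype Integrable.of_finite, Finset.smul_sum]
  refine Finset.sum_congr rfl fun x _ => ?_
  congr 1
  rw [measureReal_def, Measure.pi_singleton]
  simp

end Coins

/-! ### Sampling one term from each block. -/

section Sampling

variable {ι : Type*} {m : ℕ}

/-- The term sampled from the block number `b` with offset bits `x`. -/
def blockSample (A : Fin m → Matrix ι ι ℂ) (L b : ℕ) (x : Fin L → Bool) : Matrix ι ι ℂ :=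
  ∑ i : Fin m, if i / 2 ^ L = b ∧ i % 2 ^ L = bitsValue x then (2 ^ L : ℝ) • A i else 0

theorem isHermitian_blockSample {A : Fin m → Matrix ι ι ℂ} (hA : ∀ i, (A i).IsHermitian)
    (L b : ℕ) (x : Fin L → Bool) : (blockSample A L b x).IsHermitian := by
  refine isSelfAdjoint_sum _ fun i _ => ?_
  split_ifs
  · exact (hA i).smul (IsSelfAdjoint.all _)
  · exact isHermitian_zero

theorem sum_ite_block {N L : ℕ} (hN : m ≤ N * 2 ^ L) (A : Fin m → Matrix ι ι ℂ) :
    ∑ b : Fin N, ∑ i : Fin m, (if (i : ℕ) / 2 ^ L = b then A i else 0) = ∑ i, A i := by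
  rw [Finset.sum_comm]
  refine Finset.sum_congr rfl fun i _ => ?_
  have hlt : (i : ℕ) / 2 ^ L < N := by
    rw [Nat.div_lt_iff_lt_mul (Nat.two_pow_pos L)]; omega
  rw [Finset.sum_eq_single ⟨_, hlt⟩]
  · simp
  · intro b _ hb
    exact if_neg fun h => hb (Fin.ext h.symm)
  · simp

theorem sum_blockSample {N L : ℕ} (hN : m ≤ N * 2 ^ L) (A : Fin m → Matrix ι ι ℂ)
    (ω : ℕ → Bool) :
    ∑ b : Fin N, blockSample A L b (blockBits N L ω b) = ∑ i : Fin m, blockWeight L ω i • A i := by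
  rw [← sum_ite_block hN]
  refine Finset.sum_congr rfl fun b _ => Finset.sum_congr rfl fun i _ => ?_
  by_cases hb : (i : ℕ) / 2 ^ L = b
  · have e : bitsValue (blockBits N L ω b) =
        bitOffset (fun l => ω ((i : ℕ) / 2 ^ L * L + l)) L := by
      refine bitOffset_congr fun l hl => ?_
      rw [dif_pos hl, hb]
      rfl
    rw [e, blockWeight, if_pos hb]
    by_cases h : (i : ℕ) % 2 ^ L = bitOffset (fun l => ω ((i : ℕ) / 2 ^ L * L + l)) L
    · rw [if_pos ⟨hb, h⟩, if_pos h]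
    · rw [if_neg fun h' => h h'.2, if_neg h, zero_smul]
  · rw [if_neg hb, if_neg fun h => hb h.1]

variable [Fintype ι] [DecidableEq ι]

/-- A block number and an offset determine the index, so at most one summand is nonzero. -/
theorem norm_blockSample_le {A : Fin m → Matrix ι ι ℂ} {B : ℝ} (hB : 0 ≤ B)
    (hA : ∀ i, ‖A i‖ ≤ B) (L b : ℕ) (x : Fin L → Bool) : ‖blockSample A L b x‖ ≤ 2 ^ L * B := by
  unfold blockSample
  by_cases h : ∃ i : Fin m, (i : ℕ) / 2 ^ L = b ∧ (i : ℕ) % 2 ^ L = bitsValue x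
  · obtain ⟨i, hi⟩ := h
    rw [Finset.sum_eq_single i, if_pos hi, norm_smul]
    · rw [Real.norm_of_nonneg (by positivity)]
      exact mul_le_mul_of_nonneg_left (hA i) (by positivity)
    · intro j _ hj
      refine if_neg fun hj' => hj (Fin.ext ?_)
      rw [← Nat.div_add_mod (j : ℕ) (2 ^ L), ← Nat.div_add_mod (i : ℕ) (2 ^ L), hi.1, hi.2,
        hj'.1, hj'.2]
    · simp
  · rw [Finset.sum_eq_zero fun i _ => if_neg fun hi => h ⟨i, hi⟩, norm_zero]
    positivity

/-- Each term of the block is hit by exactly one of the `2 ^ L` bit strings, and its probability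
cancels the weight. The block need not be full: offsets past the last term contribute zero. -/
theorem integral_blockSample (A : Fin m → Matrix ι ι ℂ) (L b : ℕ) :
    ∫ x, blockSample A L b x ∂(Measure.pi fun _ : Fin L => bitLaw) =
      ∑ i : Fin m, if (i : ℕ) / 2 ^ L = b then A i else 0 := by
  rw [integral_bits]
  unfold blockSample
  rw [Finset.sum_comm, Finset.smul_sum]
  refine Finset.sum_congr rfl fun i _ => ?_
  obtain ⟨x, hx, hu⟩ := existsUnique_bitsValue_eq (Nat.mod_lt (i : ℕ) (Nat.two_pow_pos L))
  by_cases hb : (i : ℕ) / 2 ^ L = b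
  · rw [if_pos hb, Finset.sum_eq_single x, if_pos ⟨hb, hx.symm⟩, smul_smul,
      inv_mul_cancel₀ (by positivity), one_smul]
    · intro y _ hy
      exact if_neg fun h => hy (hu y h.2.symm)
    · simp
  · rw [if_neg hb, Finset.sum_eq_zero fun y _ => if_neg fun h => hb h.1, smul_zero]

/-- Sampling one term from each block preserves a sum of bounded Hermitian matrices. -/
theorem coinLaw_norm_sampled_sub_gt_le {A : Fin m → Matrix ι ι ℂ} {B : ℝ} (hB : 0 ≤ B)
    (hA : ∀ i, ‖A i‖ ≤ B) (hH : ∀ i, (A i).IsHermitian) {N L : ℕ} (hN : m ≤ N * 2 ^ L) {p : ℕ}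
    (hp : p ≠ 0) {t : ℝ} (ht : 0 < t) :
    coinLaw {ω | t < ‖∑ i : Fin m, blockWeight L ω i • A i - ∑ i, A i‖} ≤
      ENNReal.ofReal (Fintype.card ι * (N * p * (2 * (2 ^ L * B)) ^ 2 / t ^ 2) ^ p) := by
  have hbd : ∀ b : Fin N, MatrixMoment.BddMeas fun x => blockSample A L b x := fun b =>
    ⟨StronglyMeasurable.of_discrete, _, fun x => norm_blockSample_le hB hA L b x⟩
  have key := MatrixMoment.measure_norm_sum_gt_le (κ := Fin N)
    (Measure.pi fun _ : Fin L => bitLaw) hbd (fun b x => isHermitian_blockSample hH L b x)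
    (Δ := 2 * (2 ^ L * B)) (fun b x y => by
      have h1 := norm_blockSample_le hB hA L b x
      have h2 := norm_blockSample_le hB hA L b y
      have h3 := norm_sub_le (blockSample A L b x) (blockSample A L b y)
      linarith) hp ht
  rw [Fintype.card_fin, ← map_blockBits, Measure.map_apply (measurable_blockBits N L)
    MeasurableSet.of_discrete] at key
  simp_rw [integral_blockSample, sum_ite_block hN] at key
  simpa only [Set.preimage_ofPred_eq, sum_blockSample hN] using key

theorem measurable_blockWeight (L i : ℕ) : Measurable fun ω : ℕ → Bool => blockWeight L ω i := by
  have h : ∀ (q l : ℕ), Measurable fun ω : ℕ → Bool => bitOffset (fun l => ω (q + l)) l := by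
    intro q l
    induction l with
    | zero => exact measurable_const
    | succ l ih =>
      refine (ih.add ih).add ?_
      exact (measurable_from_top (f := fun b : Bool => if b then 1 else 0)).comp
        (measurable_pi_apply (q + l))
  exact (measurable_from_top (f := fun k : ℕ => if i % 2 ^ L = k then (2 : ℝ) ^ L else 0)).comp
    (h (i / 2 ^ L * L) L)

theorem blockWeight_nonneg (L : ℕ) (ω : ℕ → Bool) (i : ℕ) : 0 ≤ blockWeight L ω i := by
  unfold blockWeight
  split_ifs <;> positivity

theorem blockWeight_zero (ω : ℕ → Bool) (i : ℕ) : blockWeight 0 ω i = 1 := by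
  simp [blockWeight, bitOffset, Nat.mod_one]

/-- The block number is injective on the chosen terms, as the block fixes the offset. -/
theorem weightSize_blockWeight_le {N L : ℕ} (hN : m ≤ N * 2 ^ L) (ω : ℕ → Bool) :
    weightSize (fun i : Fin m => blockWeight L ω i) ≤ N := by
  have hmem : ∀ i : Fin m, 0 < blockWeight L ω i →
      (i : ℕ) % 2 ^ L = bitOffset (fun l => ω ((i : ℕ) / 2 ^ L * L + l)) L := by
    intro i hi
    by_contra h
    rw [blockWeight, if_neg h] at hi
    exact lt_irrefl _ hi
  have h := Set.ncard_le_ncard_of_injOn (s := {i : Fin m | 0 < blockWeight L ω i})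
    (t := (Finset.range N : Set ℕ)) (fun i => (i : ℕ) / 2 ^ L)
    (fun i _ => by
      simp only [Finset.coe_range, Set.mem_Iio]
      rw [Nat.div_lt_iff_lt_mul (Nat.two_pow_pos L)]; omega)
    (fun i hi j hj hij => by
      have h1 := hmem i hi
      have h2 := hmem j hj
      simp only at hij
      refine Fin.ext ?_
      rw [← Nat.div_add_mod (j : ℕ) (2 ^ L), ← Nat.div_add_mod (i : ℕ) (2 ^ L), h1, h2, hij])
    (Finset.finite_toSet _)
  simpa [weightSize] using h

end Sampling

end

/-! ### From norm approximation to sparsification. -/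

noncomputable section

open Matrix
open scoped Matrix.Norms.L2Operator

namespace LocalHamiltonian

variable {n m r : ℕ} (H : LocalHamiltonian n m r)

theorem energy_eq_quadForm (ψ : (Fin n → Fin 2) → ℂ) :
    H.energy ψ = quadForm (∑ i, liftTerm (H.qubits i) (H.pred i)) ψ := by
  rw [quadForm_sum]; rfl

theorem weightedEnergy_eq_quadForm (w : Fin m → ℝ) (ψ : (Fin n → Fin 2) → ℂ) :
    H.weightedEnergy w ψ = quadForm (∑ i, w i • liftTerm (H.qubits i) (H.pred i)) ψ := by
  rw [quadForm_sum]
  refine Finset.sum_congr rfl fun i _ => ?_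
  rw [quadForm_smul]; rfl

theorem energy_nonneg (hH : ∀ i, (H.pred i).PosSemidef) (ψ : (Fin n → Fin 2) → ℂ) :
    0 ≤ H.energy ψ := by
  refine Finset.sum_nonneg fun i _ => ?_
  have h := le_quadForm_liftTerm (H.qubits i) (M := H.pred i) (c := 0) (fun φ => by
    rw [zero_mul]
    exact (Complex.le_def.1 ((hH i).dotProduct_mulVec_nonneg φ)).1) ψ
  rwa [zero_mul] at h

theorem isSparsifier_zero (hH : ∀ i, (H.pred i).PosSemidef) {ε : ℝ} (hε : 1 ≤ ε) :
    H.IsSparsifier ε fun _ => 0 := by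
  refine ⟨fun _ => le_rfl, fun ψ => ?_⟩
  have h := H.energy_nonneg hH ψ
  have h0 : H.weightedEnergy (fun _ => 0) ψ = 0 := by simp [weightedEnergy]
  rw [h0]
  constructor <;> nlinarith

theorem isSparsifier_one (hH : ∀ i, (H.pred i).PosSemidef) {ε : ℝ} (hε : 0 ≤ ε) :
    H.IsSparsifier ε fun _ => 1 := by
  refine ⟨fun _ => zero_le_one, fun ψ => ?_⟩
  have h := H.energy_nonneg hH ψ
  have h0 : H.weightedEnergy (fun _ => 1) ψ = H.energy ψ := by simp [weightedEnergy, energy]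
  rw [h0]
  constructor <;> nlinarith

/-- A reweighting that approximates the Hamiltonian in norm is a sparsifier, when the Hamiltonian
approximates a well-conditioned one. -/
theorem isSparsifier_of_norm_le {w : Fin m → ℝ} (hw : ∀ i, 0 ≤ w i) {E : QMat r} {c ε : ℝ}
    (hε : 0 ≤ ε) (hE : ∀ φ, c * normSqSum φ ≤ quadForm E φ)
    (h1 : ‖∑ i, liftTerm (H.qubits i) (H.pred i) - ∑ i, liftTerm (H.qubits i) E‖ ≤ c * m / 2)
    (h2 : ‖∑ i, w i • liftTerm (H.qubits i) (H.pred i) -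
      ∑ i, liftTerm (H.qubits i) (H.pred i)‖ ≤ ε * (c * m / 2)) :
    H.IsSparsifier ε w := by
  refine ⟨hw, fun ψ => ?_⟩
  rw [energy_eq_quadForm, weightedEnergy_eq_quadForm]
  set X := ∑ i, liftTerm (H.qubits i) (H.pred i)
  set W := ∑ i, w i • liftTerm (H.qubits i) (H.pred i)
  set Y := ∑ i, liftTerm (H.qubits i) E with hY
  have hn := normSqSum_nonneg ψ
  have hYψ : m * (c * normSqSum ψ) ≤ quadForm Y ψ := by
    rw [hY, quadForm_sum]
    have := Finset.sum_le_sum fun (i : Fin m) (_ : i ∈ Finset.univ) =>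
      le_quadForm_liftTerm (H.qubits i) hE ψ
    simpa using this
  have e1 := (abs_le.1 ((abs_quadForm_le (X - Y) ψ).trans (mul_le_mul_of_nonneg_right h1 hn))).1
  obtain ⟨e2, e3⟩ := abs_le.1
    ((abs_quadForm_le (W - X) ψ).trans (mul_le_mul_of_nonneg_right h2 hn))
  rw [quadForm_sub] at e1 e2 e3
  -- The mean Hamiltonian is at least `c m` and the deviation at most `c m / 2`. So the additive
  -- error `ε c m / 2` is at most `ε` times the energy.
  have e4 : c * m / 2 * normSqSum ψ ≤ quadForm X ψ := by linarith
  have e5 := mul_le_mul_of_nonneg_left e4 hε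
  constructor <;> nlinarith

end LocalHamiltonian

/-! ### Failure probability and size. -/

section Failure

variable {n m r : ℕ}

theorem bddMeas_liftTerm_truncPSD (T : Fin r ↪ Fin n) {B : ℝ} (hB : 0 ≤ B) :
    MatrixMoment.BddMeas fun M : QMat r => liftTerm T (truncPSD r B M) :=
  ⟨(liftTermCLM T).continuous.comp_stronglyMeasurable (bddMeas_truncPSD hB).meas, B,
    fun M => (norm_liftTerm_le T _).trans (truncPSD_mem hB M).2⟩

theorem integral_liftTerm_truncPSD (D : Measure (QMat r)) [IsProbabilityMeasure D]
    (T : Fin r ↪ Fin n) {B : ℝ} (hB : 0 ≤ B) :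
    ∫ M, liftTerm T (truncPSD r B M) ∂D = liftTerm T (∫ M, truncPSD r B M ∂D) :=
  (liftTermCLM T).integral_comp_comm ((bddMeas_truncPSD hB).integrable D)

/-- A random Hamiltonian is close to its mean. -/
theorem measure_norm_sub_mean_gt_le (D : Measure (QMat r)) [IsProbabilityMeasure D]
    (T : Fin m → (Fin r ↪ Fin n)) {B : ℝ} (hB : 0 ≤ B) {p : ℕ} (hp : p ≠ 0) {t : ℝ} (ht : 0 < t) :
    (Measure.pi fun _ : Fin m => D) {M | t < ‖∑ i, liftTerm (T i) (truncPSD r B (M i)) -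
      ∑ i, liftTerm (T i) (∫ M, truncPSD r B M ∂D)‖} ≤
      ENNReal.ofReal (2 ^ n * (m * p * (2 * B) ^ 2 / t ^ 2) ^ p) := by
  have key := MatrixMoment.measure_norm_sum_gt_le (κ := Fin m) D
    (Z := fun i M => liftTerm (T i) (truncPSD r B M))
    (fun i => bddMeas_liftTerm_truncPSD (T i) hB)
    (fun i M => isHermitian_liftTerm (T i) (truncPSD_mem hB M).1.isHermitian)
    (Δ := 2 * B) (fun i M M' => by
      have h1 := (norm_liftTerm_le (T i) _).trans (truncPSD_mem hB M).2
      have h2 := (norm_liftTerm_le (T i) _).trans (truncPSD_mem hB M').2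
      have h3 := norm_sub_le (liftTerm (T i) (truncPSD r B M)) (liftTerm (T i) (truncPSD r B M'))
      linarith) hp ht
  simp_rw [integral_liftTerm_truncPSD D _ hB] at key
  simpa using key

/-- The sampled Hamiltonian is close to the given random one. -/
theorem measure_norm_sampled_sub_gt_le (D : Measure (QMat r)) [IsProbabilityMeasure D]
    (T : Fin m → (Fin r ↪ Fin n)) {B : ℝ} (hB : 0 ≤ B) {N L : ℕ} (hN : m ≤ N * 2 ^ L) {p : ℕ}
    (hp : p ≠ 0) {t : ℝ} (ht : 0 < t) :
    ((Measure.pi fun _ : Fin m => D).prod coinLaw)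
      {q | t < ‖∑ i : Fin m, blockWeight L q.2 i • liftTerm (T i) (truncPSD r B (q.1 i)) -
        ∑ i, liftTerm (T i) (truncPSD r B (q.1 i))‖} ≤
      ENNReal.ofReal (2 ^ n * (N * p * (2 * (2 ^ L * B)) ^ 2 / t ^ 2) ^ p) := by
  have hA : ∀ i, StronglyMeasurable fun q : (Fin m → QMat r) × (ℕ → Bool) =>
      liftTerm (T i) (truncPSD r B (q.1 i)) := fun i =>
    (bddMeas_liftTerm_truncPSD (T i) hB).meas.comp_measurable
      ((measurable_pi_apply i).comp measurable_fst)
  have hS : StronglyMeasurable fun q : (Fin m → QMat r) × (ℕ → Bool) =>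
      ∑ i : Fin m, blockWeight L q.2 i • liftTerm (T i) (truncPSD r B (q.1 i)) -
        ∑ i, liftTerm (T i) (truncPSD r B (q.1 i)) := by
    refine StronglyMeasurable.sub ?_ ?_
    · refine Finset.stronglyMeasurable_fun_sum _ fun i _ => ?_
      exact ((measurable_blockWeight L i).comp measurable_snd).stronglyMeasurable.smul (hA i)
    · exact Finset.stronglyMeasurable_fun_sum _ fun i _ => hA i
  -- Fubini: with the matrices frozen only the coins are random, and the bound obtained is the same
  -- for all matrices.
  rw [Measure.prod_apply (measurableSet_lt measurable_const hS.norm.measurable)]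
  refine (lintegral_mono fun M => ?_).trans (le_of_eq (lintegral_const _)) |>.trans
    (le_of_eq (by rw [measure_univ, mul_one]))
  have key := coinLaw_norm_sampled_sub_gt_le (A := fun i => liftTerm (T i) (truncPSD r B (M i)))
    hB (fun i => (norm_liftTerm_le (T i) _).trans (truncPSD_mem hB _).2)
    (fun i => isHermitian_liftTerm (T i) (truncPSD_mem hB _).1.isHermitian) hN hp ht
  simpa using key

/-- The numerical estimates for the failure probabilities and the size. -/
theorem sampling_estimates {n m L C : ℕ} (hn : 0 < n) {B c ε : ℝ} (hB : 0 < B) (hc : 0 < c)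
    (hε : 0 < ε) (hε1 : ε < 1) (hC2 : 2 ≤ C) (hC : 512 * B ^ 2 / c ^ 2 ≤ C)
    (hlt : (n * C : ℝ) * 2 ^ L < m * ε * ε) (hL : ¬ (n * C : ℝ) * 2 ^ (L + 1) < m * ε * ε) {N : ℕ}
    (hN : N * 2 ^ (L + 1) < m + 2 ^ (L + 1)) :
    0 < m ∧ (m * n * (2 * B) ^ 2 / (c * m / 2) ^ 2 : ℝ) ≤ 1 / 8 ∧
      (N * n * (2 * (2 ^ (L + 1) * B)) ^ 2 / (ε * (c * m / 2)) ^ 2 : ℝ) ≤ 1 / 8 ∧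
      (N : ℝ) ≤ (C + 1) * (n / ε ^ 2) := by
  set S : ℝ := 2 ^ L with hS
  have hS1 : 1 ≤ S := one_le_pow₀ (by norm_num)
  have hn' : (1 : ℝ) ≤ n := by exact_mod_cast hn
  have hC2' : (2 : ℝ) ≤ C := by exact_mod_cast hC2
  have hN' : (N : ℝ) * (S * 2) < m + S * 2 := by
    rw [hS, ← pow_succ]; exact_mod_cast hN
  rw [pow_succ, ← hS] at hL
  rw [not_lt] at hL
  have hCB : 512 * B ^ 2 ≤ C * c ^ 2 := by
    rwa [div_le_iff₀ (by positivity)] at hC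
  have hε2 : ε * ε ≤ 1 := by nlinarith
  have hm0 : (0 : ℝ) ≤ m := Nat.cast_nonneg m
  have hmεε : (m : ℝ) * ε * ε ≤ m := by nlinarith
  have hnC : (2 : ℝ) ≤ n * C := by nlinarith
  have hnCS : (n * C : ℝ) ≤ n * C * S := by nlinarith
  have hm : (0 : ℝ) < m := by linarith
  have hmnC : (n * C : ℝ) ≤ m := by linarith
  have hSm : S * 2 ≤ m := by nlinarith
  refine ⟨by exact_mod_cast hm, ?_, ?_, ?_⟩
  · rw [div_le_iff₀ (by positivity)]
    have h1 : 512 * B ^ 2 * n ≤ c ^ 2 * m := by nlinarith [sq_nonneg c]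
    nlinarith
  · rw [div_le_iff₀ (by positivity)]
    -- Rounding the number of blocks up costs a factor of at most `2`. The ratio is then at most `64
    -- B² n S / (c² ε² m)`, whence the constant `512 = 8 * 64`.
    have h1 : (N : ℝ) * (S * 2) ≤ 2 * m := by linarith
    have h2 : 512 * B ^ 2 * (n * S) ≤ c ^ 2 * (m * ε * ε) := by
      have h3 : C * c ^ 2 * (n * S) ≤ c ^ 2 * (m * ε * ε) := by
        have := mul_le_mul_of_nonneg_left hlt.le (sq_nonneg c)
        linarith
      exact (mul_le_mul_of_nonneg_right hCB (by positivity)).trans h3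
    have h4 : (N : ℝ) * n * (2 * (S * 2 * B)) ^ 2 ≤ 16 * m * (B ^ 2 * (n * S)) := by
      have := mul_le_mul_of_nonneg_right h1 (show 0 ≤ 8 * B ^ 2 * (n * S) by positivity)
      linarith
    have h5 := mul_le_mul_of_nonneg_left h2 hm.le
    have e : (2 : ℝ) ^ (L + 1) = S * 2 := by rw [hS, pow_succ]
    rw [e]
    linarith
  · have h1 : (m : ℝ) * ε ^ 2 ≤ n * C * (S * 2) := by linarith
    have h2 : (N : ℝ) * (S * 2) * ε ^ 2 ≤ (C + 1) * n * (S * 2) := by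
      -- The extra block from rounding up is absorbed by `1 ≤ n / ε²`, turning `C` into `C + 1`.
      have h3 : S * 2 * ε ^ 2 ≤ S * 2 * n := by
        refine mul_le_mul_of_nonneg_left ?_ (by positivity)
        nlinarith
      have h4 := mul_le_mul_of_nonneg_right hN'.le (sq_nonneg ε)
      linarith
    rw [mul_div_assoc', le_div_iff₀ (by positivity)]
    refine le_of_mul_le_mul_right ?_ (show 0 < S * 2 by positivity)
    linarith

theorem two_pow_mul_pow_le {n : ℕ} {x : ℝ} (hx0 : 0 ≤ x) (hx : x ≤ 1 / 8) :
    2 ^ n * x ^ n ≤ ((1 : ℝ) / 4) ^ n := by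
  rw [← mul_pow]
  exact pow_le_pow_left₀ (by positivity) (by linarith) n

theorem ofReal_quarter_pow_add_le {n : ℕ} (hn : 0 < n) :
    ENNReal.ofReal (((1 : ℝ) / 4) ^ n) + ENNReal.ofReal (((1 : ℝ) / 4) ^ n) ≤
      ENNReal.ofReal ((2 : ℝ) ^ (-(1 * n : ℝ))) := by
  rw [← ENNReal.ofReal_add (by positivity) (by positivity)]
  refine ENNReal.ofReal_le_ofReal ?_
  rw [one_mul, Real.rpow_neg (by norm_num), Real.rpow_natCast]
  have h1 : ((1 : ℝ) / 4) ^ n = (1 / 2) ^ n * (1 / 2) ^ n := by rw [← mul_pow]; norm_num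
  have h2 : ((1 : ℝ) / 2) ^ n ≤ 1 / 2 := by
    calc ((1 : ℝ) / 2) ^ n ≤ (1 / 2) ^ 1 :=
          pow_le_pow_of_le_one (by norm_num) (by norm_num) hn
      _ = 1 / 2 := pow_one _
  have h3 : ((2 : ℝ) ^ n)⁻¹ = (1 / 2) ^ n := by rw [one_div, inv_pow]
  have h4 : (0 : ℝ) ≤ (1 / 2) ^ n := by positivity
  rw [h1, h3]
  nlinarith

/-- Success of a program: it outputs a small sparsifier. -/
def Succeeds (A : RProg) (C : ℝ) (T : Fin m → (Fin r ↪ Fin n)) (ε : ℝ)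
    (p : (Fin m → QMat r) × (ℕ → Bool)) : Prop :=
  ∃ (s : RState) (t : ℕ),
    A.Runs ((LocalHamiltonian.mk T p.1).toInput ε) p.2 RState.start s t ∧
    (LocalHamiltonian.mk T p.1).IsSparsifier ε (s.weights m) ∧
    (weightSize (s.weights m) : ℝ) ≤ C * (n / ε ^ 2)

/-- Concentration is needed only for `ε < 1` and `L > 0`. Then level `L - 1` was rejected, so `m ε²
> C n` and there are enough terms. Otherwise, for `n > 0`, the weights are all `0` or all `1`, which
works as soon as the matrices are positive semidefinite. -/
theorem measure_not_succeeds_le {D : Measure (QMat r)} [IsProbabilityMeasure D]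
    {B c : ℝ} (hB : 0 < B) (hc : 0 < c) (hD : ∀ᵐ M ∂D, M ∈ boundedPSD r B)
    (hE : ∀ φ, c * normSqSum φ ≤ quadForm (∫ M, truncPSD r B M ∂D) φ) {C : ℕ} (hC2 : 2 ≤ C)
    (hC : 512 * B ^ 2 / c ^ 2 ≤ C) (T : Fin m → (Fin r ↪ Fin n)) {ε : ℝ} (hε : 0 < ε) :
    ((Measure.pi fun _ : Fin m => D).prod coinLaw)
      {p | ¬ Succeeds (samplingProgram C) (C + 1) T ε p} ≤
      ENNReal.ofReal ((2 : ℝ) ^ (-(1 * n : ℝ))) := by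
  set P := (Measure.pi fun _ : Fin m => D).prod coinLaw with hP
  -- For `n = 0` the claimed bound on the probability is `1`.
  rcases Nat.eq_zero_or_pos n with hn | hn
  · refine prob_le_one.trans (le_of_eq ?_)
    simp [hn]
  have hgood : ∀ᵐ p ∂P, ∀ i, p.1 i ∈ boundedPSD r B := by
    rw [ae_all_iff]
    intro i
    exact (((Measure.quasiMeasurePreserving_eval (fun _ : Fin m => D) i).comp
      Measure.quasiMeasurePreserving_fst).ae hD)
  have hzero : (∀ p : (Fin m → QMat r) × (ℕ → Bool), (∀ i, p.1 i ∈ boundedPSD r B) →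
      Succeeds (samplingProgram C) (C + 1) T ε p) →
      P {p | ¬ Succeeds (samplingProgram C) (C + 1) T ε p} ≤
        ENNReal.ofReal ((2 : ℝ) ^ (-(1 * n : ℝ))) := by
    intro h
    have h0 : ∀ᵐ p ∂P, Succeeds (samplingProgram C) (C + 1) T ε p :=
      hgood.mono fun p hp => h p hp
    rw [ae_iff.1 h0]
    exact zero_le
  rcases le_or_gt 1 ε with hε1 | hε1
  · refine hzero fun p hp => ?_
    obtain ⟨s, hs, hout⟩ :=
      runs_samplingProgram_of_one_le p.2 (LocalHamiltonian.mk T p.1) hε1 C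
    have hw : s.weights m = fun _ => 0 := funext fun i => hout i
    refine ⟨s, 7, hs, ?_, ?_⟩
    · rw [hw]
      exact LocalHamiltonian.isSparsifier_zero _ (fun i => (hp i).1) hε1
    · rw [hw]
      simp only [weightSize, lt_irrefl, Set.ofPred_false, Set.ncard_empty, Nat.cast_zero]
      positivity
  obtain ⟨L, -, hlt, hL⟩ := exists_level (m := m) (C := C) (fun h => absurd h hn.ne')
    (by omega) hε hε1
  have hrun : ∀ p : (Fin m → QMat r) × (ℕ → Bool), ∃ s t,
      (samplingProgram C).Runs ((LocalHamiltonian.mk T p.1).toInput ε) p.2 RState.start s t ∧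
      s.weights m = fun i : Fin m => blockWeight L p.2 i := by
    intro p
    obtain ⟨s, t, hs, -, hw⟩ :=
      runs_samplingProgram p.2 (LocalHamiltonian.mk T p.1) hε1 C hlt hL
    exact ⟨s, t, hs, funext fun i => hw i i.2⟩
  rcases Nat.eq_zero_or_pos L with rfl | hLpos
  · refine hzero fun p hp => ?_
    obtain ⟨s, t, hs, hw⟩ := hrun p
    have hm : (m : ℝ) ≤ (C + 1) * (n / ε ^ 2) := by
      rw [mul_div_assoc', le_div_iff₀ (by positivity)]
      rw [not_lt, pow_zero, mul_one] at hL
      nlinarith [Nat.cast_nonneg (α := ℝ) n]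
    refine ⟨s, t, hs, ?_, le_trans ?_ hm⟩
    · rw [hw]
      simp_rw [blockWeight_zero]
      exact LocalHamiltonian.isSparsifier_one _ (fun i => (hp i).1) hε.le
    · rw [hw]
      exact_mod_cast weightSize_blockWeight_le (by simp) p.2
  obtain ⟨L, rfl⟩ := Nat.exists_eq_add_of_lt hLpos
  rw [zero_add] at *
  obtain ⟨N, hN1, hN2⟩ : ∃ N, m ≤ N * 2 ^ (L + 1) ∧ N * 2 ^ (L + 1) < m + 2 ^ (L + 1) := by
    have hS : 0 < 2 ^ (L + 1) := Nat.two_pow_pos _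
    generalize 2 ^ (L + 1) = S at hS
    have h1 := Nat.lt_div_mul_add hS (a := m + S - 1)
    have h2 := Nat.div_mul_le_self (m + S - 1) S
    exact ⟨(m + S - 1) / S, by omega, by omega⟩
  obtain ⟨hm, q1, q2, hsize⟩ := sampling_estimates hn hB hc hε hε1 hC2 hC
    (hlt L (Nat.lt_succ_self L)) hL hN2
  have hm' : (0 : ℝ) < m := by exact_mod_cast hm
  have b1 := measure_norm_sub_mean_gt_le D T hB.le hn.ne' (t := c * m / 2) (by positivity)
  have b2 := measure_norm_sampled_sub_gt_le D T hB.le hN1 hn.ne' (t := ε * (c * m / 2))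
    (by positivity)
  set F₁ := {M : Fin m → QMat r | c * m / 2 < ‖∑ i, liftTerm (T i) (truncPSD r B (M i)) -
      ∑ i, liftTerm (T i) (∫ M, truncPSD r B M ∂D)‖} with hF₁
  set F₂ := {q : (Fin m → QMat r) × (ℕ → Bool) | ε * (c * m / 2) <
    ‖∑ i : Fin m, blockWeight (L + 1) q.2 i • liftTerm (T i) (truncPSD r B (q.1 i)) -
        ∑ i, liftTerm (T i) (truncPSD r B (q.1 i))‖} with hF₂
  -- The inclusion holds almost everywhere only, where truncation leaves the matrices unchanged.
  have hsub : ∀ᵐ p ∂P, p ∈ {p | ¬ Succeeds (samplingProgram C) (C + 1) T ε p} →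
      p ∈ (F₁ ×ˢ (Set.univ : Set (ℕ → Bool))) ∪ F₂ := by
    filter_upwards [hgood] with p hp hfail
    by_contra hnot
    refine hfail ?_
    rw [Set.mem_union, not_or] at hnot
    have g1 : ¬ p.1 ∈ F₁ := fun h => hnot.1 ⟨h, Set.mem_univ _⟩
    have g2 : ¬ p ∈ F₂ := hnot.2
    simp only [hF₁, hF₂, Set.mem_ofPred_eq, not_lt, truncPSD_of_mem (hp _)] at g1 g2
    obtain ⟨s, t, hs, hw⟩ := hrun p
    refine ⟨s, t, hs, ?_, le_trans ?_ hsize⟩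
    · rw [hw]
      exact LocalHamiltonian.isSparsifier_of_norm_le (LocalHamiltonian.mk T p.1)
        (fun i => blockWeight_nonneg _ _ _) hε.le hE g1 g2
    · rw [hw]
      exact_mod_cast weightSize_blockWeight_le hN1 p.2
  refine (measure_mono_ae hsub).trans ((measure_union_le _ _).trans ?_)
  refine le_trans (add_le_add ?_ ?_) (ofReal_quarter_pow_add_le hn)
  · rw [hP, Measure.prod_prod, measure_univ, mul_one]
    exact b1.trans (ENNReal.ofReal_le_ofReal (two_pow_mul_pow_le (by positivity) q1))
  · exact b2.trans (ENNReal.ofReal_le_ofReal (two_pow_mul_pow_le (by positivity) q2))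

end Failure

end

theorem mainTheorem3 :
    -- absolute constants: probability exponent, power of the logarithm, polynomial for the time
    ∃ c : ℝ, 0 < c ∧ ∃ k K : ℕ,
      ∀ (r R : ℕ), 1 ≤ r → 2 ^ (r - 1) + 1 ≤ R →
      ∀ (D : Measure (QMat r)) [IsProbabilityMeasure D], IsPredicateLaw r R D →
      ∃ (C : ℝ) (A : RProg),
        -- the algorithm halts in polynomial time on every input and for every coin sequence
        (∀ (n m : ℕ) (H : LocalHamiltonian n m r) (ε : ℝ), 0 < ε → ∀ ω : ℕ → Bool,
          ∃ (s : RState) (t : ℕ), A.Runs (H.toInput ε) ω RState.start s t ∧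
            t ≤ K * (n + m + 1) ^ K) ∧
        -- jointly over the matrices and the coins, it fails with probability at most `2 ^ (-c n)`
        ∀ (n m : ℕ) (T : Fin m → (Fin r ↪ Fin n)) (ε : ℝ), 0 < ε →
          ((Measure.pi fun _ : Fin m => D).prod coinLaw)
            {p : (Fin m → QMat r) × (ℕ → Bool) |
              ¬ ∃ (s : RState) (t : ℕ),
                A.Runs ((LocalHamiltonian.mk T p.1).toInput ε) p.2 RState.start s t ∧
                (LocalHamiltonian.mk T p.1).IsSparsifier ε (s.weights m) ∧
                (weightSize (s.weights m) : ℝ) ≤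
                  C * (n / ε ^ 2) * Real.log (n + 2) ^ k}
            ≤ ENNReal.ofReal ((2 : ℝ) ^ (-(c * n))) := by
  refine ⟨1, one_pos, 0, 16, fun r R hr hR D hprob hD => ?_⟩
  obtain ⟨B, c, hB, hc, hmem, hE⟩ := hD.exists_bounds ((Nat.succ_pos _).trans_le hR)
  -- The summand `2` gives `C ≥ 2`, which makes a block of length `2 ^ (L + 1)` no longer than `m`
  -- in `sampling_estimates`.
  set C : ℕ := ⌈512 * B ^ 2 / c ^ 2⌉₊ + 2 with hCdef
  have hC : 512 * B ^ 2 / c ^ 2 ≤ C := by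
    rw [hCdef]
    push_cast
    linarith [Nat.le_ceil (512 * B ^ 2 / c ^ 2)]
  refine ⟨C + 1, samplingProgram C, fun n m H ε hε ω =>
    samplingProgram_halts ω hr H hε (by omega), fun n m T ε hε => ?_⟩
  have key := measure_not_succeeds_le hB hc hmem hE (by omega) hC T hε
  simpa only [pow_zero, mul_one, Succeeds] using key
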